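/- Let $\mathbb K$ be a field with $\operatorname{char}\mathbb K\neq 2$ and $\mathbb P^3$ the projective three-space over $\mathbb K$; $\vee$ denotes the span of projective subspaces. **Nets.** A net is a map $f\colon\mathbb Z^2\to\mathbb P^3$, $(i,j)\mapsto f_i^j$. Put $\mathcal O_1f_i^j=f_{i-1}^j\vee f_i^j\vee f_{i+1}^j$ and $\mathcal O_2f_i^j=f_i^{j-1}\vee f_i^j\vee f_i^{j+1}$. The net is *conjugate* if all its elementary quadrilaterals $f_i^j,f_{i+1}^j,f_{i+1}^{j+1},f_i^{j+1}$ are planar, and *regular* if all $\mathcal O_1f_i^j,\mathcal O_2f_i^j$ are planes and no elementary quadrilateral is collinear. The Laplace transforms of a regular conjugate net are $(\mathcal L_1f)_i^j=(f_i^j\vee f_{i+1}^j)\cap(f_i^{j+1}\vee f_{i+1}^{j+1})$ and $(\mathcal L_2f)_i^j=(f_i^j\vee f_i^{j+1})\cap(f_{i+1}^j\vee f_{i+1}^{j+1})$. **Cycles.** A *Laplace cycle of period four* consists of regular conjugate nets $f,h,g,k$ with $h=\mathcal L_1f$, $k=\mathcal L_2f$ and $g_{i+1}^{j+1}=(\mathcal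 L_1h)_i^j=(\mathcal L_2k)_i^j$ for all $i,j$. Its *diagonal congruence* is $A_i^j=f_i^j\vee g_i^j$. The cycle is *in general position* if for all $i,j$ we have $f_i^j\ne g_i^j$, $h_i^j\neq k_i^j$, the two osculating planes $\mathcal O_1,\mathcal O_2$ of each of the four nets at $(i,j)$ are distinct, and $A_i^j$ is skew to $A_{i+1}^j$ and to $A_i^{j+1}$. The diagonal congruence *has skew opposite lines* if $A_i^j\cap A_{i+1}^{j+1}=\varnothing=A_{i+1}^j\cap A_i^{j+1}$ for all $i,j$. **Quadrics.** The regulus of three pairwise skew lines is the set of lines that meet all common transversals of the three lines; the quadric through the three lines is the set of points on the lines of their regulus. **Data.** Points $f_i^0,f_0^i$ and lines $A_i^0,A_0^i$ ($i\in\mathbb Z$, with common values at $(0,0)$) are in *suitable position* if for all $i$: $A_i^0\cap A_{i+1}^0=\varnothing=A_0^i\cap A_0^{i+1}$; $A_i^0\subset f_{i-1}^0\vee f_i^0\vee f_{i+1}^0$ and $A_0^i\subset f_0^{i-1}\vee f_0^i\vee f_0^{i+1}$; $f_i^0\in A_i^0$ and $f_0^i\in A_0^i$. If moreover $A_1^0\cap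 A_0^1=\varnothing$, let $C$ be the intersection of the plane $f_0^0\vee f_1^0\vee f_0^1$ with the quadric through $A_0^0,A_1^0,A_0^1$. **Projection step.** For signs $s,t\in\{1,-1\}$ let $\mathcal Q$ be the quadric through $A_i^j,A_{i+s}^j,A_i^{j+t}$ and $D=\mathcal Q\cap(f_i^j\vee f_{i+s}^j\vee f_i^{j+t})$. The horizontal step produces $f_{i+s}^{j+t}$ as the point other than $f_i^{j+t}$ of $D\cap(f_{i-s}^{j+t}\vee A_i^{j+t})$; the vertical step produces it as the point other than $f_{i+s}^j$ of $D\cap(f_{i+s}^{j-t}\vee A_{i+s}^j)$. In both cases $A_{i+s}^{j+t}$ is the line of the regulus of $A_i^j,A_{i+s}^j,A_i^{j+t}$ through $f_{i+s}^{j+t}$. From data on the axes and a point $x=f_1^1\in C$ (with $A_1^1$ the line through $x$ of the regulus of $A_0^0,A_1^0,A_0^1$), the *construction* obtains first, by vertical steps, all $f_1^j,A_1^j$, and then, by horizontal steps, successively the rows $j=1,2,\dots$ and $j=-1,-2,\dots$. It is *free of singularities* if it yields a point $f_i^j$ and a line $A_i^j$ for all $(i,j)$, the four lines $A$ of every elementary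 quadrilateral are pairwise skew, $f$ is regular with $\mathcal O_1f_i^j\ne\mathcal O_2f_i^j$ for all $i,j$, and $\mathcal L_1f$, $\mathcal L_2f$ are regular. **Theorem.** 1. For every Laplace cycle $f,h,g,k$ of period four in general position with diagonal congruence $A$, the values of $f$ and $A$ on all vertices $(i,0)$ and $(0,i)$ are in suitable position, and if $A_1^0\cap A_0^1=\varnothing$, then $f_1^1\in C$. 2. Such a cycle is uniquely determined by these values and $f_1^1$: if two Laplace cycles of period four in general position have the same $f$ and $A$ on all vertices $(i,0)$, $(0,i)$ and the same $f_1^1$, then all four nets coincide. 3. Given points and lines on the axes in suitable position with $A_1^0\cap A_0^1=\varnothing$, and $x\in C$, a Laplace cycle of period four in general position, whose diagonal congruence has skew opposite lines, with these values of $f$ and $A$ on the axes and with $f_1^1=x$, exists if and only if the construction from these data is free of singularities. 4. In every Laplace cycle of period four in general position whose diagonal congruence has skew opposite lines, the horizontal and the vertical projection step both reproduce $f_{i+s}^{j+t}$ and $A_{i+s}^{j+t}$, for all $i,j\in\mathbb Z$ and $s,t\in\{1,-1\}$; so all routes of projections lead to the same values. -/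

import Mathlib

open scoped LinearAlgebra.Projectivization

noncomputable section

namespace LaplaceCycles

/-! Points of projective three-space are the elements of Mathlib's `ℙ K (Fin 4 → K)`.  Lines,
planes, spans `∨` and intersections `∩` of projective subspaces are taken in the lattice of linear
subspaces of `K⁴`: a line has linear dimension two, a plane has linear dimension three, disjoint
projective subspaces have intersection `⊥`. -/

/-- Projective three-space over `K`. -/
abbrev Pt (K : Type*) [Field K] := ℙ K (Fin 4 → K)

/-- Projective subspaces of three-space, as linear subspaces of `K⁴`. -/
abbrev Sub (K : Type*) [Field K] := Submodule K (Fin 4 → K)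

/-- A discrete net; `f i j` is the vertex with lower index `i` and upper index `j`. -/
abbrev Net (K : Type*) [Field K] := ℤ → ℤ → Pt K

/-- A two-parameter family of projective subspaces (used for line congruences). -/
abbrev Congruence (K : Type*) [Field K] := ℤ → ℤ → Sub K

section Basic

variable {K : Type*} [Field K]

def IsLine (L : Sub K) : Prop := Module.finrank K L = 2

/-- Disjoint projective subspaces. -/
def Skew (L M : Sub K) : Prop := L ⊓ M = ⊥

def Meets (L M : Sub K) : Prop := L ⊓ M ≠ ⊥

/-- The span of two points. -/
def join2 (x y : Pt K) : Sub K := x.submodule ⊔ y.submodule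

/-- The span of three points. -/
def join3 (x y z : Pt K) : Sub K := x.submodule ⊔ y.submodule ⊔ z.submodule

end Basic

section Nets

variable {K : Type*} [Field K]

/-- Osculating plane in the first net direction. -/
def osc1 (f : Net K) (i j : ℤ) : Sub K := join3 (f (i - 1) j) (f i j) (f (i + 1) j)

/-- Osculating plane in the second net direction. -/
def osc2 (f : Net K) (i j : ℤ) : Sub K := join3 (f i (j - 1)) (f i j) (f i (j + 1))

/-- The span of the vertices of an elementary quadrilateral. -/
def face (f : Net K) (i j : ℤ) : Sub K :=
  join2 (f i j) (f (i + 1) j) ⊔ join2 (f i (j + 1)) (f (i + 1) (j + 1))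

/-- All elementary quadrilaterals are planar. -/
def IsConjugate (f : Net K) : Prop := ∀ i j, Module.finrank K (face f i j) ≤ 3

/-- The osculating planes are planes, and no elementary quadrilateral is collinear. -/
structure IsRegular (f : Net K) : Prop where
  osc1_plane : ∀ i j, Module.finrank K (osc1 f i j) = 3
  osc2_plane : ∀ i j, Module.finrank K (osc2 f i j) = 3
  not_collinear : ∀ i j, 2 < Module.finrank K (face f i j)

/-- `h` is the first Laplace transform of `f`. -/
def IsLaplace1 (f h : Net K) : Prop :=
  ∀ i j, (h i j).submodule = join2 (f i j) (f (i + 1) j) ⊓ join2 (f i (j + 1)) (f (i + 1) (j + 1))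

/-- `k` is the second Laplace transform of `f`. -/
def IsLaplace2 (f k : Net K) : Prop :=
  ∀ i j, (k i j).submodule = join2 (f i j) (f i (j + 1)) ⊓ join2 (f (i + 1) j) (f (i + 1) (j + 1))

/-- The nets `f, h, g, k` form a Laplace cycle of period four: all of them are regular conjugate
nets, `h` and `k` are the two Laplace transforms of `f`, and the first Laplace transform of `h`
equals the second Laplace transform of `k`.  The net `g` is this common transform, indexed so
that `g i j` is the vertex opposite to `f i j`, that is, `g i j` lies in the osculating planes
of `f` at `(i, j)`. -/
structure IsLaplaceCycle (f h g k : Net K) : Prop where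
  f_conj : IsConjugate f
  h_conj : IsConjugate h
  g_conj : IsConjugate g
  k_conj : IsConjugate k
  f_reg : IsRegular f
  h_reg : IsRegular h
  g_reg : IsRegular g
  k_reg : IsRegular k
  h_eq : IsLaplace1 f h
  k_eq : IsLaplace2 f k
  g_eq_first : IsLaplace1 h (fun i j => g (i + 1) (j + 1))
  g_eq_second : IsLaplace2 k (fun i j => g (i + 1) (j + 1))

/-- The diagonal congruence: the lines joining corresponding points of opposite nets. -/
def diagonal (f g : Net K) : Congruence K := fun i j => join2 (f i j) (g i j)

/-- Neighbouring lines are skew. -/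
def AdjacentSkew (A : Congruence K) : Prop :=
  ∀ i j, Skew (A i j) (A (i + 1) j) ∧ Skew (A i j) (A i (j + 1))

/-- The two pairs of opposite lines of every elementary quadrilateral are skew. -/
def OppositeSkew (A : Congruence K) : Prop :=
  ∀ i j, Skew (A i j) (A (i + 1) (j + 1)) ∧ Skew (A (i + 1) j) (A i (j + 1))

/-- Corresponding points of opposite nets are distinct, the two osculating planes at every vertex
are distinct, and neighbouring lines of the diagonal congruence through `f` are skew. -/
structure InGeneralPosition (f h g k : Net K) : Prop where
  f_ne_g : ∀ i j, f i j ≠ g i j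
  h_ne_k : ∀ i j, h i j ≠ k i j
  osc_f : ∀ i j, osc1 f i j ≠ osc2 f i j
  osc_h : ∀ i j, osc1 h i j ≠ osc2 h i j
  osc_g : ∀ i j, osc1 g i j ≠ osc2 g i j
  osc_k : ∀ i j, osc1 k i j ≠ osc2 k i j
  skew : AdjacentSkew (diagonal f g)

end Nets

section Quadrics

variable {K : Type*} [Field K]

/-- The regulus of three pairwise skew lines: all lines that meet every common transversal
of the three lines. -/
def regulus (A B C : Sub K) : Set (Sub K) :=
  {L | IsLine L ∧ ∀ T : Sub K, IsLine T → Meets T A → Meets T B → Meets T C → Meets T L}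

/-- The quadric through three pairwise skew lines: all points on the lines of their regulus. -/
def quadric (A B C : Sub K) : Set (Pt K) := {y | ∃ L ∈ regulus A B C, y.submodule ≤ L}

/-- The line of the regulus of `A, B, C` through the point `y` (the join of all such lines; there
is exactly one if `A, B, C` are pairwise skew and `y` is on their quadric). -/
def regulusLine (A B C y : Sub K) : Sub K := sSup {L | L ∈ regulus A B C ∧ y ≤ L}

/-- The projection of the point `x` from the line `Z` onto the conic in which the plane `π` cuts
the quadric through `A, B, Z`; here `z = Z ∩ π`.  It is the point different from `z` in the
intersection of that conic with the plane `x ∨ Z` (the join of all such points). -/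
def conicProjection (A B Z π z x : Sub K) : Sub K :=
  sSup {S | ∃ y : Pt K, y ∈ quadric A B Z ∧ y.submodule ≤ π ∧ y.submodule ≤ x ⊔ Z ∧
    y.submodule ≠ z ∧ S = y.submodule}

end Quadrics

section Construction

variable {K : Type*} [Field K]

/-- A point together with a line. -/
abbrev Flag (K : Type*) [Field K] := Sub K × Sub K

/-- The values of a net and a line congruence on the vertices `(i, 0)` and `(0, i)`. -/
@[ext]
structure AxisData (K : Type*) [Field K] where
  /-- values of the net at `(i, 0)` -/
  fx : ℤ → Pt K
  /-- values of the net at `(0, i)` -/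
  fy : ℤ → Pt K
  /-- values of the congruence at `(i, 0)` -/
  Ax : ℤ → Sub K
  /-- values of the congruence at `(0, i)` -/
  Ay : ℤ → Sub K

/-- The values of `f` and of the diagonal congruence on the axes. -/
def axisData (f g : Net K) : AxisData K where
  fx i := f i 0
  fy i := f 0 i
  Ax i := diagonal f g i 0
  Ay i := diagonal f g 0 i

/-- Points and lines on the axes in suitable position. -/
structure AxisData.IsSuitable (d : AxisData K) : Prop where
  f_origin : d.fx 0 = d.fy 0
  A_origin : d.Ax 0 = d.Ay 0
  line_x : ∀ i, IsLine (d.Ax i)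
  line_y : ∀ i, IsLine (d.Ay i)
  skew_x : ∀ i, Skew (d.Ax i) (d.Ax (i + 1))
  skew_y : ∀ i, Skew (d.Ay i) (d.Ay (i + 1))
  osc_x : ∀ i, d.Ax i ≤ join3 (d.fx (i - 1)) (d.fx i) (d.fx (i + 1))
  osc_y : ∀ i, d.Ay i ≤ join3 (d.fy (i - 1)) (d.fy i) (d.fy (i + 1))
  mem_x : ∀ i, (d.fx i).submodule ≤ d.Ax i
  mem_y : ∀ i, (d.fy i).submodule ≤ d.Ay i

/-- The conic cut out by the plane of the points at `(0,0), (1,0), (0,1)` from the quadric through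
the lines at these vertices. -/
def AxisData.conic (d : AxisData K) : Set (Pt K) :=
  {y | y ∈ quadric (d.Ax 0) (d.Ax 1) (d.Ay 1) ∧ y.submodule ≤ join3 (d.fx 0) (d.fx 1) (d.fy 1)}

/-- The vertex of `f` and the line of the diagonal congruence at `(i, j)`. -/
def cycleFlag (f g : Net K) (i j : ℤ) : Flag K := ((f i j).submodule, diagonal f g i j)

/-- One step of the construction: the fourth vertex of an elementary quadrilateral with known
vertices `a` and its neighbours `b`, `c`.  Its point is the projection of the point `x` from
the line of `c`, its line is the line of the regulus through that point.  (Here `x` is the point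
on the far side of `c`: it belongs to the vertex that together with the wanted one encloses `c`
on a parameter line.) -/
def nextFlag (a b c : Flag K) (x : Sub K) : Flag K :=
  let y := conicProjection a.2 b.2 c.2 (a.1 ⊔ b.1 ⊔ c.1) c.1 x
  (y, regulusLine a.2 b.2 c.2 y)

/-- Given a complete parameter line `rail` and the entries `0` and `1` of a neighbouring parameter
line, construct its entries `0, 1, 2, …` one after the other. -/
def ray (rail : ℤ → Flag K) (s₀ s₁ : Flag K) : ℕ → Flag K
  | 0 => s₀
  | 1 => s₁
  | n + 2 => nextFlag (rail (n + 1)) (rail (n + 2)) (ray rail s₀ s₁ (n + 1)) (ray rail s₀ s₁ n).1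

/-- Given a complete parameter line `rail` and the entries `0` and `1` of a neighbouring parameter
line, construct all entries of that line, in both directions. -/
def extend (rail : ℤ → Flag K) (s₀ s₁ : Flag K) (i : ℤ) : Flag K :=
  if 0 ≤ i then ray rail s₀ s₁ i.toNat
  else ray (fun n => rail (1 - n)) s₁ s₀ (1 - i).toNat

/-- The first coordinate axis. -/
def AxisData.row0 (d : AxisData K) (i : ℤ) : Flag K := ((d.fx i).submodule, d.Ax i)

/-- The second coordinate axis. -/
def AxisData.col0 (d : AxisData K) (j : ℤ) : Flag K := ((d.fy j).submodule, d.Ay j)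

/-- The parameter line of the vertices `(1, j)`, constructed from the axes and the point `x`
at `(1, 1)`. -/
def AxisData.col1 (d : AxisData K) (x : Pt K) : ℤ → Flag K :=
  extend d.col0 (d.row0 1)
    (x.submodule, regulusLine (d.Ax 0) (d.Ax 1) (d.Ay 1) x.submodule)

/-- The parameter lines of the vertices `(i, s * n)`, `s = 1` or `s = -1`, constructed one after
the other for `n = 0, 1, 2, …`. -/
def AxisData.row (d : AxisData K) (x : Pt K) (s : ℤ) : ℕ → ℤ → Flag K
  | 0 => d.row0
  | n + 1 => extend (d.row x s n) (d.col0 (s * (n + 1))) (d.col1 x (s * (n + 1)))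

/-- The point and the line at `(i, j)` constructed by successive projections from the values on
the axes and the point `x` at `(1, 1)`. -/
def AxisData.construct (d : AxisData K) (x : Pt K) (i j : ℤ) : Flag K :=
  d.row x j.sign j.natAbs i

/-- The construction does not run into a singularity: it produces points and lines, the net of
points is regular with distinct osculating planes, its Laplace transforms are regular, and the
four lines of every elementary quadrilateral are pairwise skew. -/
def AxisData.ConstructionRegular (d : AxisData K) (x : Pt K) : Prop :=
  ∃ (f : Net K) (A : Congruence K),
    (∀ i j, d.construct x i j = ((f i j).submodule, A i j)) ∧
    (∀ i j, IsLine (A i j)) ∧ AdjacentSkew A ∧ OppositeSkew A ∧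
    IsRegular f ∧ (∀ i j, osc1 f i j ≠ osc2 f i j) ∧
    (∀ h : Net K, IsLaplace1 f h → IsRegular h) ∧ (∀ k : Net K, IsLaplace2 f k → IsRegular k)

end Construction

end LaplaceCycles

end

/-! Every elementary quadrilateral of a cycle has a vector normal form, `QuadFrame`. The points of
`f` are F, F-H, F-N, F-H-N, those of `g` are G, G-mN, G-lH, G-lH-mN, where F, G, H, N is a basis of
K⁴ and l, m are nonzero. H is common to the horizontal edges of `f` and the vertical edges of `g`,
and N to the remaining edges, so they represent the two Laplace transforms. Skewness of the opposite
lines at b and c forces l ≠ m. The theorem splits into computations in one frame and the gluing of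
frames.

In one frame with l ≠ m, the fourth line belongs to the regulus of the other three
(`line_mem_regulus`), and the line joining the points of c and d meets the quadric only in these two
points (`quadric_equation`). In a cycle, the diagonal line lies in both osculating planes, so the
plane spanned by that line and a neighbouring point is an osculating plane and contains the next
point. It cuts the plane of the quadrilateral in the line cd, so projection finds the fourth vertex
(`QuadFrame.nextFlag_eq`). Even for l = m, three corners and that plane determine the fourth corner
(`eq_of_plane`), and induction along the order of the construction gives uniqueness.

Conversely, four pairwise skew lines of a regulus with suitable coplanar points have a frame
(`LaplaceCycles.exists_quadFrame`), so a construction without singularities yields frames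
everywhere. The point G at a vertex is the intersection of its line with the common line of two
neighbouring osculating planes, so it does not depend on the quadrilateral (`span_G_eq`,
`corner_unique`). Horizontal steps put the lines into the first osculating planes. For the second
osculating planes this is known only in columns 0 and 1, and `line_b_le` carries it from column to
column. Frames that fit together in this way form a cycle (`HasCycleFrames.isLaplaceCycle`). -/

namespace LaplaceCycles

open Module Submodule

/-! ### Vectors, lines and points in K⁴. -/

section LinearAlgebra

variable {K : Type*} [Field K]

/-- Linear independence of two vectors. -/
def Indep2 (a b : Fin 4 → K) : Prop := ∀ s t : K, s • a + t • b = 0 → s = 0 ∧ t = 0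

/-- Linear independence of four vectors. -/
def Indep4 (F G H N : Fin 4 → K) : Prop :=
  ∀ a b c d : K, a • F + b • G + c • H + d • N = 0 → a = 0 ∧ b = 0 ∧ c = 0 ∧ d = 0

variable {F G H N a b c d : Fin 4 → K}

theorem Indep4.linearIndependent (hI : Indep4 F G H N) : LinearIndependent K ![F, G, H, N] := by
  rw [Fintype.linearIndependent_iff]
  intro g hg i
  obtain ⟨h0, h1, h2, h3⟩ := hI (g 0) (g 1) (g 2) (g 3) (by
    simpa [Fin.sum_univ_succ, add_assoc] using hg)
  fin_cases i <;> assumption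

theorem Indep4.exists_coords (hI : Indep4 F G H N) (v : Fin 4 → K) :
    ∃ x y z w : K, v = x • F + y • G + z • H + w • N := by
  have hs := hI.linearIndependent.span_eq_top_of_card_eq_finrank (by simp)
  have hv : v ∈ span K (Set.range ![F, G, H, N]) := hs ▸ mem_top
  obtain ⟨g, hg⟩ := (Submodule.mem_span_range_iff_exists_fun K).1 hv
  exact ⟨g 0, g 1, g 2, g 3, by rw [← hg]; simp [Fin.sum_univ_succ, add_assoc]⟩

theorem Indep4.eq_top (hI : Indep4 F G H N) {P : Sub K} (h1 : F ∈ P) (h2 : G ∈ P) (h3 : H ∈ P)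
    (h4 : N ∈ P) : P = ⊤ := by
  rw [eq_top_iff]
  rintro v -
  obtain ⟨x, y, z, w, rfl⟩ := hI.exists_coords v
  exact P.add_mem (P.add_mem (P.add_mem (P.smul_mem _ h1) (P.smul_mem _ h2)) (P.smul_mem _ h3))
    (P.smul_mem _ h4)

/-- A plane does not contain four independent vectors. -/
theorem Indep4.notMem_plane (hI : Indep4 F G H N) {P : Sub K} (hP : finrank K P ≤ 3) (h1 : F ∈ P)
    (h2 : G ∈ P) (h3 : H ∈ P) : N ∉ P := by
  intro h4
  rw [hI.eq_top h1 h2 h3 h4] at hP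
  simp at hP

theorem skew_iff {L M : Sub K} : Skew L M ↔ ∀ v ∈ L, v ∈ M → v = 0 := by
  unfold Skew
  rw [← disjoint_iff, Submodule.disjoint_def]

theorem Skew.symm {L M : Sub K} (h : Skew L M) : Skew M L := by
  unfold Skew at *; rwa [inf_comm]

theorem meets_iff {L M : Sub K} : Meets L M ↔ ∃ v ∈ L, v ∈ M ∧ v ≠ 0 := by
  unfold Meets
  rw [Submodule.ne_bot_iff]
  simp [and_assoc]

theorem Indep2.finrank_span (h : Indep2 a b) : finrank K (span K {a, b}) = 2 := by
  have hl : LinearIndependent K ![a, b] := LinearIndependent.pair_iff.2 h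
  have := finrank_span_eq_card hl
  rwa [Matrix.range_cons_cons_empty, Fintype.card_fin] at this

theorem Indep2.isLine (h : Indep2 a b) : IsLine (span K {a, b}) := h.finrank_span

theorem Indep2.ne_zero_left (h : Indep2 a b) : a ≠ 0 := by
  rintro rfl
  simpa using (h 1 0 (by simp)).1

theorem Indep2.ne_zero_right (h : Indep2 a b) : b ≠ 0 := by
  rintro rfl
  simpa using (h 0 1 (by simp)).2

theorem indep2_of_notMem (ha : a ≠ 0) (h : b ∉ span K {a}) : Indep2 a b := by
  intro s t e
  have ht : t = 0 := by
    by_contra ht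
    refine h (mem_span_singleton.2 ⟨-(t⁻¹ * s), ?_⟩)
    have : b = t⁻¹ • (t • b) := by rw [smul_smul, inv_mul_cancel₀ ht, one_smul]
    rw [this, eq_neg_of_add_eq_zero_right e]
    module
  subst ht
  simpa [ha] using e

theorem span_singleton_le {v : Fin 4 → K} {L : Sub K} : span K {v} ≤ L ↔ v ∈ L :=
  Submodule.span_singleton_le_iff_mem v L

theorem span_pair_le {L : Sub K} (ha : a ∈ L) (hb : b ∈ L) : span K {a, b} ≤ L := by
  rw [span_le]; rintro x (rfl | rfl) <;> assumption

theorem left_mem_span_pair : a ∈ span K {a, b} := subset_span (by simp)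

theorem right_mem_span_pair : b ∈ span K {a, b} := subset_span (by simp)

theorem span_sup_span : span K {a} ⊔ span K {b} = span K {a, b} := by
  rw [← span_union]; rfl

theorem IsLine.eq_span {L : Sub K} (hL : IsLine L) (h : Indep2 a b) (ha : a ∈ L) (hb : b ∈ L) :
    L = span K {a, b} :=
  (eq_of_le_of_finrank_eq (span_pair_le ha hb) (by rw [h.finrank_span, hL])).symm

theorem IsLine.eq_of_le {L M : Sub K} (hL : IsLine L) (hM : IsLine M) (h : L ≤ M) : L = M :=
  eq_of_le_of_finrank_eq h (hL.trans hM.symm)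

/-- A nonzero vector of a line extends to a basis of the line. -/
theorem IsLine.exists_right {L : Sub K} (hL : IsLine L) (ha : a ∈ L) (h0 : a ≠ 0) :
    ∃ b, Indep2 a b ∧ L = span K {a, b} := by
  obtain ⟨b, hb, hn⟩ : ∃ b ∈ L, b ∉ span K {a} := by
    by_contra! h
    have h1 := finrank_mono (R := K) (show L ≤ span K {a} from h)
    rw [finrank_span_singleton h0, hL] at h1
    omega
  have h2 := indep2_of_notMem h0 hn
  exact ⟨b, h2, hL.eq_span h2 ha hb⟩

theorem IsLine.ne_bot {L : Sub K} (hL : IsLine L) : L ≠ ⊥ := by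
  rintro rfl
  unfold IsLine at hL
  simp at hL

theorem IsLine.exists_basis {L : Sub K} (hL : IsLine L) :
    ∃ a b, Indep2 a b ∧ L = span K {a, b} := by
  obtain ⟨a, ha, h0⟩ := (Submodule.ne_bot_iff _).1 hL.ne_bot
  obtain ⟨b, hb⟩ := hL.exists_right ha h0
  exact ⟨a, b, hb⟩

theorem Skew.indep4 (h1 : Indep2 a b) (h2 : Indep2 c d)
    (h : Skew (span K {a, b}) (span K {c, d})) : Indep4 a b c d := by
  intro x y z w e
  have e' : x • a + y • b = (-z) • c + (-w) • d := by
    linear_combination (norm := module) e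
  have h0 := skew_iff.1 h _ (mem_span_pair.2 ⟨x, y, rfl⟩) (mem_span_pair.2 ⟨-z, -w, e'.symm⟩)
  obtain ⟨hx, hy⟩ := h1 _ _ h0
  obtain ⟨hz, hw⟩ := h2 _ _ (e'.symm.trans h0)
  exact ⟨hx, hy, by simpa using hz, by simpa using hw⟩

theorem Indep4.skew (hI : Indep4 a b c d) : Skew (span K {a, b}) (span K {c, d}) := by
  rw [skew_iff]
  intro v h1 h2
  obtain ⟨x, y, rfl⟩ := mem_span_pair.1 h1
  obtain ⟨z, w, e⟩ := mem_span_pair.1 h2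
  obtain ⟨rfl, rfl, -, -⟩ := hI x y (-z) (-w) (by linear_combination (norm := module) -e)
  simp

theorem Skew.indep2 {L M : Sub K} (h : Skew L M) (ha : a ∈ L) (hb : b ∈ M) (h0 : a ≠ 0)
    (h1 : b ≠ 0) : Indep2 a b := by
  refine indep2_of_notMem h0 fun hm => h1 (skew_iff.1 h b ?_ hb)
  exact (span_singleton_le.2 ha) hm

theorem finrank_span_pair_le : finrank K (span K {a, b}) ≤ 2 := by
  classical
  have := finrank_span_le_card (R := K) ({a, b} : Set (Fin 4 → K))
  refine this.trans ?_
  simp only [Set.toFinset_insert, Set.toFinset_singleton]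
  exact Finset.card_le_two

theorem finrank_span_triple_le : finrank K (span K {a, b, c}) ≤ 3 := by
  classical
  have := finrank_span_le_card (R := K) ({a, b, c} : Set (Fin 4 → K))
  refine this.trans ?_
  simp only [Set.toFinset_insert, Set.toFinset_singleton]
  exact Finset.card_le_three

theorem finrank_point_sup_line {x L : Sub K} (hx : finrank K x ≤ 1) (hL : IsLine L) :
    finrank K (x ⊔ L : Sub K) ≤ 3 := by
  have := Submodule.finrank_add_le_finrank_add_finrank x L
  unfold IsLine at hL
  omega

theorem Pt.exists_vec (x : Pt K) : ∃ v, v ≠ 0 ∧ x.submodule = span K {v} :=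
  ⟨x.rep, x.rep_nonzero, x.submodule_eq⟩

theorem Pt.exists_of_vec {v : Fin 4 → K} (hv : v ≠ 0) : ∃ x : Pt K, x.submodule = span K {v} :=
  ⟨Projectivization.mk K v hv, Projectivization.submodule_mk v hv⟩

theorem Pt.finrank (x : Pt K) : Module.finrank K x.submodule = 1 := x.finrank_submodule

theorem Pt.eq_of_le {x y : Pt K} (h : x.submodule ≤ y.submodule) : x = y :=
  Projectivization.submodule_injective (eq_of_le_of_finrank_eq h (by rw [Pt.finrank, Pt.finrank]))

theorem span_singleton_eq_of_smul {u v : Fin 4 → K} {r : K} (hr : r ≠ 0) (h : u = r • v) :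
    span K {u} = span K {v} := by
  rw [h, span_singleton_smul_eq (IsUnit.mk0 r hr)]

theorem exists_smul_of_span_eq {u v : Fin 4 → K} (hv : v ≠ 0) (h : span K {u} = span K {v}) :
    ∃ r : K, r ≠ 0 ∧ u = r • v := by
  obtain ⟨r, hr⟩ := mem_span_singleton.1 (h ▸ mem_span_singleton_self u)
  refine ⟨r, ?_, hr.symm⟩
  rintro rfl
  rw [← hr, zero_smul, span_zero_singleton] at h
  exact hv (span_singleton_eq_bot.1 h.symm)

end LinearAlgebra

/-! ### The normal form of a quadrilateral and the regulus of its lines. -/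

section Frames

variable {K : Type*} [Field K]

/-- Normal form of an elementary quadrilateral of a Laplace cycle of period four.  The points of
the net are `F, F - H, F - N, F - H - N`, those of the opposite net are
`G, G - m N, G - l H, G - l H - m N`, and `H`, `N` are the two Laplace transforms. -/
structure QuadFrame (a b c d : Flag K) (F G H N : Fin 4 → K) (l m : K) : Prop where
  indep : Indep4 F G H N
  l_ne : l ≠ 0
  m_ne : m ≠ 0
  a_pt : a.1 = span K {F}
  b_pt : b.1 = span K {F - H}
  c_pt : c.1 = span K {F - N}
  d_pt : d.1 = span K {F - H - N}
  a_line : a.2 = span K {F, G}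
  b_line : b.2 = span K {F - H, G - m • N}
  c_line : c.2 = span K {F - N, G - l • H}
  d_line : d.2 = span K {F - H - N, G - l • H - m • N}

variable {a b c d : Flag K} {F G H N : Fin 4 → K} {l m : K}

namespace QuadFrame

/-- The normal form is symmetric under exchange of the two net directions, so each horizontal
statement has a vertical twin. -/
theorem swap (h : QuadFrame a b c d F G H N l m) : QuadFrame a c b d F G N H m l where
  indep x y z w e := by
    obtain ⟨h1, h2, h3, h4⟩ := h.indep x y w z (by linear_combination (norm := module) e)
    exact ⟨h1, h2, h4, h3⟩
  l_ne := h.m_ne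
  m_ne := h.l_ne
  a_pt := h.a_pt
  b_pt := h.c_pt
  c_pt := h.b_pt
  d_pt := by rw [h.d_pt, sub_right_comm]
  a_line := h.a_line
  b_line := h.c_line
  c_line := h.b_line
  d_line := by rw [h.d_line, sub_right_comm F, sub_right_comm G]

/-- Any corner may serve as base: passing from a to b only changes the signs of H, l and m. With
`flip'` this covers all four sign choices of a step. -/
theorem flip (h : QuadFrame a b c d F G H N l m) :
    QuadFrame b a d c (F - H) (G - m • N) (-H) N (-l) (-m) where
  indep x y z w e := by
    obtain ⟨h1, h2, h3, h4⟩ := h.indep x y (-x - z) (w - m * y)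
      (by linear_combination (norm := module) e)
    subst h1 h2
    exact ⟨rfl, rfl, by simpa using h3, by simpa using h4⟩
  l_ne := neg_ne_zero.2 h.l_ne
  m_ne := neg_ne_zero.2 h.m_ne
  a_pt := h.b_pt
  b_pt := by rw [h.a_pt, sub_neg_eq_add, sub_add_cancel]
  c_pt := h.d_pt
  d_pt := by rw [h.c_pt, sub_neg_eq_add, sub_add_cancel]
  a_line := h.b_line
  b_line := by rw [h.a_line, sub_neg_eq_add, sub_add_cancel, neg_smul, sub_neg_eq_add,
    sub_add_cancel]
  c_line := by rw [h.d_line, neg_smul_neg, sub_right_comm G]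
  d_line := by
    rw [h.c_line]
    congr 2
    · abel
    · congr 1; module

theorem flip' (h : QuadFrame a b c d F G H N l m) :
    QuadFrame c d a b (F - N) (G - l • H) H (-N) (-l) (-m) := h.swap.flip.swap

theorem skew_ab (h : QuadFrame a b c d F G H N l m) : Skew a.2 b.2 := by
  rw [h.a_line, h.b_line]
  refine Indep4.skew fun x y z w e => ?_
  obtain ⟨h1, h2, h3, h4⟩ := h.indep (x + z) (y + w) (-z) (-(w * m))
    (by linear_combination (norm := module) e)
  have hw : w = 0 := by simpa [h.m_ne] using h4
  have hz : z = 0 := by simpa using h3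
  subst hw hz
  exact ⟨by simpa using h1, by simpa using h2, rfl, rfl⟩

theorem skew_ac (h : QuadFrame a b c d F G H N l m) : Skew a.2 c.2 := h.swap.skew_ab

/-- For l = m the lines b and c share the vector l(F - H) + (G - lN) = l(F - N) + (G - lH). -/
theorem ne_of_skew (h : QuadFrame a b c d F G H N l m) (hs : Skew b.2 c.2) : l ≠ m := by
  rintro rfl
  rw [h.b_line, h.c_line, skew_iff] at hs
  have h0 := hs (l • (F - H) + (1 : K) • (G - l • N)) (mem_span_pair.2 ⟨_, _, rfl⟩)
    (mem_span_pair.2 ⟨l, 1, by module⟩)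
  have := (h.indep l 1 (-l) (-l) (by linear_combination (norm := module) h0)).2.1
  exact one_ne_zero this

theorem indep_a (h : QuadFrame a b c d F G H N l m) : Indep2 F G := fun s t e => by
  obtain ⟨h1, h2, -, -⟩ := h.indep s t 0 0 (by linear_combination (norm := module) e)
  exact ⟨h1, h2⟩

theorem isLine_a (h : QuadFrame a b c d F G H N l m) : IsLine a.2 := h.a_line ▸ h.indep_a.isLine

theorem isLine_c (h : QuadFrame a b c d F G H N l m) : IsLine c.2 := h.flip'.isLine_a

theorem isLine_d (h : QuadFrame a b c d F G H N l m) : IsLine d.2 := h.flip.isLine_c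

/-- The fourth line of the quadrilateral belongs to the regulus of the other three. -/
theorem line_mem_regulus (h : QuadFrame a b c d F G H N l m) (hlm : l ≠ m) :
    d.2 ∈ regulus a.2 b.2 c.2 := by
  refine ⟨h.isLine_d, fun T hT hA hB hC => ?_⟩
  obtain ⟨u, huT, hu, hu0⟩ := meets_iff.1 hA
  obtain ⟨v, hvT, hv, hv0⟩ := meets_iff.1 hB
  obtain ⟨w, hwT, hw, hw0⟩ := meets_iff.1 hC
  have hI := h.skew_ab.indep2 hu hv hu0 hv0
  rw [hT.eq_span hI huT hvT] at hwT
  obtain ⟨α, β, hwe⟩ := mem_span_pair.1 hwT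
  rw [h.a_line] at hu
  rw [h.b_line] at hv
  rw [h.c_line] at hw
  obtain ⟨p, q, rfl⟩ := mem_span_pair.1 hu
  obtain ⟨a', b', rfl⟩ := mem_span_pair.1 hv
  obtain ⟨s, t, rfl⟩ := mem_span_pair.1 hw
  obtain ⟨e1, e2, e3, e4⟩ := h.indep (α * p + β * a' - s) (α * q + β * b' - t)
    (l * t - β * a') (s - β * m * b') (by linear_combination (norm := module) hwe)
  have hβ : β ≠ 0 := by
    rintro rfl
    have hs : s = 0 := by linear_combination e4
    have ht : t = 0 := by
      have : l * t = 0 := by linear_combination e3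
      simpa [h.l_ne] using this
    subst hs ht
    simp at hw0
  have e5 : α * p = β * (m * b' - a') := by linear_combination e1 + e4
  have e6 : l * (α * q) = β * (a' - l * b') := by linear_combination l * e2 + e3
  have e7 : (l * α) • (p • F + q • G) = (l * (α * p)) • F + (l * (α * q)) • G := by module
  rw [meets_iff]
  -- The H- and N-coordinates of the vector on b determine one vector on d with the same
  -- coordinates; the factor m - l clears denominators. Its F- and G-coordinates are then corrected
  -- by a multiple of the vector on a, as `e5` and `e6` allow.
  refine ⟨(β * (m - l)) • (a' • (F - H) + b' • (G - m • N)) - (l * α) • (p • F + q • G),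
    T.sub_mem (T.smul_mem _ hvT) (T.smul_mem _ huT), ?_, fun h0 => ?_⟩
  · rw [h.d_line]
    refine mem_span_pair.2 ⟨β * m * (a' - l * b'), β * (m * b' - a'), ?_⟩
    rw [e7, e5, e6]
    module
  · have := (hI (-(l * α)) (β * (m - l)) (by linear_combination (norm := module) h0)).2
    exact (mul_ne_zero hβ (sub_ne_zero.2 hlm.symm)) this

/-- A line of the regulus meets three particular common transversals of the lines `a, b, c`. -/
theorem meets_transversals (h : QuadFrame a b c d F G H N l m) {L : Sub K}
    (hL : L ∈ regulus a.2 b.2 c.2) :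
    (∃ x y : K, x • (F - H) + y • (G - l • F) ∈ L ∧ (x ≠ 0 ∨ y ≠ 0)) ∧
    (∃ x y : K, x • (G - m • N) + y • (m • F - G) ∈ L ∧ (x ≠ 0 ∨ y ≠ 0)) ∧
    (∃ x y : K, x • (F - H - N) + y • G ∈ L ∧ (x ≠ 0 ∨ y ≠ 0)) := by
  have hne : ∀ x y z w : K, x ≠ 0 ∨ y ≠ 0 ∨ z ≠ 0 ∨ w ≠ 0 →
      x • F + y • G + z • H + w • N ≠ 0 := fun x y z w hx h0 => by
    obtain ⟨h1, h2, h3, h4⟩ := h.indep _ _ _ _ h0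
    simp [h1, h2, h3, h4] at hx
  have hm := h.m_ne
  have hl := h.l_ne
  have key : ∀ u v : Fin 4 → K, Indep2 u v → Meets (span K {u, v}) a.2 →
      Meets (span K {u, v}) b.2 → Meets (span K {u, v}) c.2 →
      ∃ x y : K, x • u + y • v ∈ L ∧ (x ≠ 0 ∨ y ≠ 0) := fun u v hI hA hB hC => by
    obtain ⟨z, hz, hzL, hz0⟩ := meets_iff.1 (hL.2 _ hI.isLine hA hB hC)
    obtain ⟨x, y, rfl⟩ := mem_span_pair.1 hz
    refine ⟨x, y, hzL, ?_⟩
    by_contra! h0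
    simp [h0.1, h0.2] at hz0
  refine ⟨key _ _ ?_ ?_ ?_ ?_, key _ _ ?_ ?_ ?_ ?_, key _ _ ?_ ?_ ?_ ?_⟩
  · intro s t e
    obtain ⟨h1, h2, h3, -⟩ := h.indep (s - t * l) t (-s) 0
      (by linear_combination (norm := module) e)
    exact ⟨by simpa using h3, h2⟩
  · exact meets_iff.2 ⟨_, right_mem_span_pair, h.a_line ▸ mem_span_pair.2 ⟨-l, 1, by module⟩,
      by convert hne (-l) 1 0 0 (by simp) using 1; module⟩
  · exact meets_iff.2 ⟨_, left_mem_span_pair, h.b_line ▸ left_mem_span_pair,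
      by convert hne 1 0 (-1) 0 (by simp) using 1; module⟩
  · exact meets_iff.2 ⟨G - l • H, mem_span_pair.2 ⟨l, 1, by module⟩,
      h.c_line ▸ right_mem_span_pair, by convert hne 0 1 (-l) 0 (by simp) using 1; module⟩
  · intro s t e
    obtain ⟨h1, h2, h3, h4⟩ := h.indep (t * m) (s - t) 0 (-(s * m))
      (by linear_combination (norm := module) e)
    exact ⟨by simpa [hm] using h4, by simpa [hm] using h1⟩
  · exact meets_iff.2 ⟨_, right_mem_span_pair, h.a_line ▸ mem_span_pair.2 ⟨m, -1, by module⟩,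
      by convert hne m (-1) 0 0 (by simp) using 1; module⟩
  · exact meets_iff.2 ⟨_, left_mem_span_pair, h.b_line ▸ right_mem_span_pair,
      by convert hne 0 1 0 (-m) (by simp) using 1; module⟩
  · exact meets_iff.2 ⟨m • (F - N), mem_span_pair.2 ⟨1, 1, by module⟩,
      h.c_line ▸ Submodule.smul_mem _ _ left_mem_span_pair,
      by convert hne m 0 0 (-m) (by simp [hm]) using 1; module⟩
  · intro s t e
    obtain ⟨h1, h2, h3, h4⟩ := h.indep s t (-s) (-s) (by linear_combination (norm := module) e)
    exact ⟨h1, h2⟩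
  · exact meets_iff.2 ⟨_, right_mem_span_pair, h.a_line ▸ right_mem_span_pair,
      by convert hne 0 1 0 0 (by simp) using 1; module⟩
  · exact meets_iff.2 ⟨m • (F - H - N) + (1 : K) • G, mem_span_pair.2 ⟨_, _, rfl⟩,
      h.b_line ▸ mem_span_pair.2 ⟨m, 1, by module⟩,
      by convert hne m 1 (-m) (-m) (by simp) using 1; module⟩
  · exact meets_iff.2 ⟨l • (F - H - N) + (1 : K) • G, mem_span_pair.2 ⟨_, _, rfl⟩,
      h.c_line ▸ mem_span_pair.2 ⟨l, 1, by module⟩,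
      by convert hne l 1 (-l) (-l) (by simp) using 1; module⟩

theorem eq_of_mem_regulus (h : QuadFrame a b c d F G H N l m) {L : Sub K}
    (hL : L ∈ regulus a.2 b.2 c.2) (hd : d.1 ≤ L) : L = d.2 := by
  rw [h.d_pt, span_singleton_le] at hd
  obtain ⟨⟨a', b', h1, h10⟩, ⟨c', d', h2, h20⟩, -⟩ := h.meets_transversals hL
  have hm := h.m_ne
  have hl := h.l_ne
  have hI : Indep2 (F - H - N) (a' • (F - H) + b' • (G - l • F)) := by
    intro s t e
    obtain ⟨e1, e2, e3, e4⟩ := h.indep (s + t * (a' - b' * l)) (t * b') (-s - t * a') (-s)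
      (by linear_combination (norm := module) e)
    have hs : s = 0 := by simpa using e4
    subst hs
    refine ⟨rfl, ?_⟩
    by_contra ht
    have hb : b' = 0 := by simpa [ht] using e2
    have ha : a' = 0 := by simpa [ht] using e3
    simp [ha, hb] at h10
  -- L is spanned by the point of d and its point on the first transversal; meeting the second
  -- transversal fixes the ratio of a' and b'.
  have hLe := hL.1.eq_span hI hd h1
  rw [hLe] at h2
  obtain ⟨s, t, e⟩ := mem_span_pair.1 h2
  obtain ⟨e1, e2, e3, e4⟩ := h.indep (s + t * (a' - b' * l) - d' * m) (t * b' - c' + d')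
    (-s - t * a') (-s + m * c') (by linear_combination (norm := module) e)
  have ht : t ≠ 0 := by
    rintro rfl
    have hs : s = 0 := by linear_combination -e3
    subst hs
    have hc : c' = 0 := by simpa [hm] using e4
    have hd' : d' = 0 := by simpa [hm] using e1
    simp [hc, hd'] at h20
  have e5 : a' = (l - m) * b' := by
    apply mul_left_cancel₀ ht
    linear_combination e1 + m * e2 + e4
  refine hL.1.eq_of_le h.isLine_d ?_
  rw [hLe, h.d_line]
  refine span_pair_le left_mem_span_pair (mem_span_pair.2 ⟨-(m * b'), b', ?_⟩)
  rw [e5]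
  module

theorem regulusLine_eq (h : QuadFrame a b c d F G H N l m) (hlm : l ≠ m) :
    regulusLine a.2 b.2 c.2 d.1 = d.2 := by
  refine le_antisymm (sSup_le fun L hL => (h.eq_of_mem_regulus hL.1 hL.2).le)
    (le_sSup ⟨h.line_mem_regulus hlm, ?_⟩)
  rw [h.d_pt, h.d_line, span_singleton_le]
  exact left_mem_span_pair

/-- The equation of the quadric, restricted to the line joining the points of `c` and `d`. -/
theorem quadric_equation (h : QuadFrame a b c d F G H N l m) (hlm : l ≠ m) {L : Sub K}
    (hL : L ∈ regulus a.2 b.2 c.2) {p q : K} (hy : p • (F - N) + q • H ∈ L) :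
    q * (p + q) = 0 := by
  obtain ⟨⟨a', b', h1, h10⟩, ⟨c', d', h2, h20⟩, ⟨e₀, f', h3, h30⟩⟩ := h.meets_transversals hL
  have hm := h.m_ne
  have hl := h.l_ne
  have hml : m - l ≠ 0 := sub_ne_zero.2 hlm.symm
  have hI : Indep2 (a' • (F - H) + b' • (G - l • F)) (c' • (G - m • N) + d' • (m • F - G)) := by
    intro s t e
    obtain ⟨e1, e2, e3, e4⟩ := h.indep (s * (a' - b' * l) + t * d' * m) (s * b' + t * (c' - d'))
      (-s * a') (-(t * c') * m) (by linear_combination (norm := module) e)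
    have e5 : t * c' = 0 := by simpa [hm] using e4
    have e6 : s * a' = 0 := by simpa using e3
    have e7 : (m - l) * (t * d') = 0 := by linear_combination e1 + l * e2 - e6 - l * e5
    have e8 : t * d' = 0 := by simpa [hml] using e7
    have e9 : s * b' = 0 := by linear_combination e2 - e5 + e8
    constructor
    · by_contra hs
      simp [hs] at e6 e9
      simp [e6, e9] at h10
    · by_contra ht
      simp [ht] at e5 e8
      simp [e5, e8] at h20
  have hLe := hL.1.eq_span hI h1 h2
  rw [hLe] at h3 hy
  obtain ⟨s, t, e⟩ := mem_span_pair.1 h3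
  obtain ⟨s', t', e'⟩ := mem_span_pair.1 hy
  obtain ⟨e1, e2, e3, e4⟩ := h.indep (s * (a' - b' * l) + t * d' * m - e₀)
    (s * b' + t * (c' - d') - f') (-s * a' + e₀) (-(t * c') * m + e₀)
    (by linear_combination (norm := module) e)
  obtain ⟨k1, k2, k3, k4⟩ := h.indep (s' * (a' - b' * l) + t' * d' * m - p)
    (s' * b' + t' * (c' - d')) (-s' * a' - q) (-(t' * c') * m + p)
    (by linear_combination (norm := module) e')
  have hs : s ≠ 0 := by
    rintro rfl
    have he : e₀ = 0 := by linear_combination e3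
    subst he
    have e5 : t * c' = 0 := by simpa [hm] using e4
    have e6 : t * d' = 0 := by simpa [hm] using e1
    have hf : f' ≠ 0 := by simpa using h30
    apply hf
    linear_combination -e2 + e5 - e6
  have ht : t ≠ 0 := by
    rintro rfl
    have he : e₀ = 0 := by linear_combination e4
    subst he
    have e5 : s * a' = 0 := by simpa using e3
    have e6 : s * b' = 0 := by
      have : l * (s * b') = 0 := by linear_combination -e1 + e5
      simpa [hl] using this
    have hf : f' ≠ 0 := by simpa using h30
    apply hf
    linear_combination -e2 + e6
  -- The points on the first two transversals span L. That L also meets the third one is this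
  -- bilinear relation between their parameters, the condition cutting out the regulus.
  have e5 : a' * d' = l * b' * c' := by
    have : s * t * m * (a' * d' - l * b' * c') = 0 := by
      linear_combination (s * a') * (e1 + e3) + l * s * b' * (e4 - e3)
    simpa [hs, ht, hm, sub_eq_zero] using this
  have hp : p = s' * (a' - b' * l) + t' * d' * m := by linear_combination -k1
  have hq : q = -s' * a' := by linear_combination -k3
  have key : m * (q * (p + q)) = 0 := by
    subst hp hq
    linear_combination -s' * t' * m * (m - l) * e5 + l * (-(t' * c') * m) * k4
      - l * m * (-s' * a' + t' * c' * m) * k2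
  simpa [hm] using key

end QuadFrame
end Frames

/-! ### Projection steps and gluing in terms of normal forms. -/

section Steps

variable {K : Type*} [Field K]

theorem span_sup_span_sup_span {u v w : Fin 4 → K} :
    span K {u} ⊔ span K {v} ⊔ span K {w} = span K {u, v, w} := by
  rw [← span_union, ← span_union, Set.union_assoc]; rfl

theorem mem_sup_span {u v w z : Fin 4 → K} :
    z ∈ span K {u} ⊔ span K {v} ⊔ span K {w} ↔ ∃ x y t : K, x • u + y • v + t • w = z := by
  rw [span_sup_span_sup_span, mem_span_triple]

variable {a b c d d' e e' : Flag K} {F G H N F' G' H' N' : Fin 4 → K} {l m l' m' : K}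

namespace QuadFrame

theorem F_ne (h : QuadFrame a b c d F G H N l m) : F ≠ 0 := h.indep_a.ne_zero_left

theorem G_ne (h : QuadFrame a b c d F G H N l m) : G ≠ 0 := h.indep_a.ne_zero_right

theorem H_ne (h : QuadFrame a b c d F G H N l m) : H ≠ 0 := by
  rintro rfl
  simpa using h.indep 0 0 1 0 (by simp)

theorem N_ne (h : QuadFrame a b c d F G H N l m) : N ≠ 0 := h.swap.H_ne

/-- The plane of the line at `c` and the point at `d`. -/
theorem plane_cd (h : QuadFrame a b c d F G H N l m) {P : Sub K} (hP : finrank K P ≤ 3)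
    (hc : c.2 ≤ P) (hd : d.1 ≤ P) : F - N ∈ P ∧ G ∈ P ∧ H ∈ P ∧ N ∉ P := by
  rw [h.c_line] at hc
  rw [h.d_pt, span_singleton_le] at hd
  have h1 : F - N ∈ P := hc left_mem_span_pair
  have h2 : G - l • H ∈ P := hc right_mem_span_pair
  have h3 : H ∈ P := by
    have := P.sub_mem h1 hd
    rwa [show F - N - (F - H - N) = H by abel] at this
  have h4 : G ∈ P := by
    have := P.add_mem h2 (P.smul_mem l h3)
    rwa [sub_add_cancel] at this
  refine ⟨h1, h4, h3, Indep4.notMem_plane ?_ hP h1 h4 h3⟩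
  intro x y z w e
  obtain ⟨h1, h2, h3, h4⟩ := h.indep x y z (w - x) (by linear_combination (norm := module) e)
  subst h1
  exact ⟨rfl, h2, h3, by simpa using h4⟩

/-- The plane of the line at `a` and the point at `b`. -/
theorem plane_ab (h : QuadFrame a b c d F G H N l m) {P : Sub K} (hP : finrank K P ≤ 3)
    (ha : a.2 ≤ P) (hb : b.1 ≤ P) : F ∈ P ∧ G ∈ P ∧ H ∈ P ∧ N ∉ P := by
  rw [h.a_line] at ha
  rw [h.b_pt, span_singleton_le] at hb
  have h1 : F ∈ P := ha left_mem_span_pair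
  have h2 : G ∈ P := ha right_mem_span_pair
  have h3 : H ∈ P := by
    have := P.sub_mem h1 hb
    rwa [sub_sub_cancel] at this
  exact ⟨h1, h2, h3, Indep4.notMem_plane h.indep hP h1 h2 h3⟩

theorem d_mem_plane (h : QuadFrame a b c d F G H N l m) : d.1 ≤ a.1 ⊔ b.1 ⊔ c.1 := by
  rw [h.a_pt, h.b_pt, h.c_pt, h.d_pt, span_singleton_le, mem_sup_span]
  exact ⟨-1, 1, 1, by module⟩

/-- The plane of projection and the plane of the quadrilateral meet in the line cd. On it the
quadric has the equation q(p + q) = 0, whose roots are the points of c and d. -/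
theorem conicProjection_eq (h : QuadFrame a b c d F G H N l m) (hlm : l ≠ m) {x : Sub K}
    (hx : finrank K (x ⊔ c.2 : Sub K) ≤ 3) (hd : d.1 ≤ x ⊔ c.2) :
    conicProjection a.2 b.2 c.2 (a.1 ⊔ b.1 ⊔ c.1) c.1 x = d.1 := by
  apply le_antisymm
  · refine sSup_le ?_
    rintro _ ⟨y, ⟨L, hL, hyL⟩, hπ, hP, hne, rfl⟩
    obtain ⟨v, hv0, hv⟩ := Pt.exists_vec y
    rw [hv] at hyL hπ hP hne ⊢
    rw [span_singleton_le] at hyL hπ hP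
    rw [h.a_pt, h.b_pt, h.c_pt, mem_sup_span] at hπ
    obtain ⟨p, q, r, rfl⟩ := hπ
    obtain ⟨h1, h2, h3, h4⟩ := h.plane_cd hx le_sup_right hd
    -- The plane contains F - N and H but not N, so modulo it only the term (p + q)N survives; its
    -- vanishing puts the point on the line cd.
    have h5 : (p + q) • N ∈ x ⊔ c.2 := by
      have := Submodule.sub_mem _ hP (Submodule.sub_mem _ (Submodule.smul_mem _ (p + q + r) h1)
        (Submodule.smul_mem _ q h3))
      convert this using 1
      module
    have h6 : p + q = 0 := by
      by_contra h0
      exact h4 ((Submodule.smul_mem_iff _ h0).1 h5)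
    obtain rfl : p = -q := by linear_combination h6
    have h7 := h.quadric_equation hlm hL (p := r) (q := -q) (by convert hyL using 1; module)
    rcases mul_eq_zero.1 h7 with h8 | h8
    · obtain rfl : q = 0 := by simpa using h8
      exfalso
      apply hne
      rw [h.c_pt]
      have hr : r ≠ 0 := by
        rintro rfl
        simp at hv0
      exact span_singleton_eq_of_smul hr (by module)
    · obtain rfl : r = q := by linear_combination h8
      rw [h.d_pt, span_singleton_le, mem_span_singleton]
      exact ⟨r, by module⟩
  · obtain ⟨y, hy⟩ := Pt.exists_of_vec h.flip.flip'.F_ne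
    rw [← h.d_pt] at hy
    refine le_sSup ⟨y, ⟨d.2, h.line_mem_regulus hlm, ?_⟩, ?_, ?_, ?_, hy.symm⟩
    · rw [hy, h.d_pt, h.d_line, span_singleton_le]
      exact left_mem_span_pair
    · exact hy.le.trans h.d_mem_plane
    · exact hy.le.trans hd
    · rw [hy, h.d_pt, h.c_pt]
      intro e
      obtain ⟨r, -, hr⟩ := exists_smul_of_span_eq h.flip'.F_ne e
      have := (h.indep (1 - r) 0 (-1) (r - 1) (by linear_combination (norm := module) hr)).2.2.1
      simp at this

theorem nextFlag_eq (h : QuadFrame a b c d F G H N l m) (hlm : l ≠ m) {x : Sub K}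
    (hx : finrank K (x ⊔ c.2 : Sub K) ≤ 3) (hd : d.1 ≤ x ⊔ c.2) : nextFlag a b c x = d := by
  unfold nextFlag
  simp only [h.conicProjection_eq hlm hx hd, h.regulusLine_eq hlm]

theorem a_scale (h : QuadFrame a b c d F G H N l m) (h' : QuadFrame a b c d' F' G' H' N' l' m') :
    ∃ r : K, r ≠ 0 ∧ F' = r • F :=
  exists_smul_of_span_eq h.F_ne (h'.a_pt.symm.trans h.a_pt)

/-- Membership of G' - l'H' in the line of c removes the F-component of G', and the line of b then
forces t = r. Hence F, H, N are all scaled by r and G by one further factor, which leaves the flag d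
unchanged. -/
theorem eq_of_scale (h : QuadFrame a b c d F G H N l m)
    (h' : QuadFrame a b c d' F' G' H' N' l' m') {r t : K} (hF : F' = r • F) (hH : H' = r • H)
    (hN : F' - N' = t • (F - N)) : d = d' := by
  have hr : r ≠ 0 := by
    rintro rfl
    exact h'.F_ne (by simpa using hF)
  have hN' : N' = (r - t) • F + t • N := by
    rw [hF] at hN
    linear_combination (norm := module) -hN
  have hG : G' ∈ a.2 := h'.a_line ▸ right_mem_span_pair
  have hb : G' - m' • N' ∈ b.2 := h'.b_line ▸ right_mem_span_pair
  have hc : G' - l' • H' ∈ c.2 := h'.c_line ▸ right_mem_span_pair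
  rw [h.a_line] at hG
  rw [h.b_line] at hb
  rw [h.c_line] at hc
  obtain ⟨x, y, rfl⟩ := mem_span_pair.1 hG
  obtain ⟨s1, t1, e1⟩ := mem_span_pair.1 hb
  obtain ⟨s2, t2, e2⟩ := mem_span_pair.1 hc
  rw [hN'] at e1
  rw [hH] at e2
  obtain ⟨p1, p2, p3, p4⟩ := h.indep (s1 - x + m' * (r - t)) (t1 - y) (-s1) (m' * t - t1 * m)
    (by linear_combination (norm := module) e1)
  obtain ⟨q1, q2, q3, q4⟩ := h.indep (s2 - x) (t2 - y) (l' * r - t2 * l) (-s2)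
    (by linear_combination (norm := module) e2)
  have hx : x = 0 := by linear_combination -q1 - q4
  have hrt : r = t := by
    have : m' * (r - t) = 0 := by linear_combination p1 + p3 + hx
    simpa [h'.m_ne, sub_eq_zero] using this
  subst hrt hx
  have e3 : m' * r = y * m := by linear_combination p4 + m * p2
  have e4 : l' * r = y * l := by linear_combination q3 + l * q2
  have hy : y ≠ 0 := by
    rintro rfl
    exact h'.G_ne (by simp)
  have hN2 : N' = r • N := by rw [hN']; module
  have e5 : F' - H' - N' = r • (F - H - N) := by
    rw [hF, hH, hN2]; module
  have e6 : (0 : K) • F + y • G - l' • H' - m' • N' = y • (G - l • H - m • N) := by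
    rw [hH, hN2, smul_smul, smul_smul, e3, e4]; module
  have h1 : d.1 = d'.1 := by
    rw [h.d_pt, h'.d_pt, e5, span_singleton_smul_eq (IsUnit.mk0 r hr)]
  have h2 : d.2 = d'.2 := by
    have hd : IsLine d'.2 := h'.isLine_d
    rw [h'.d_line] at hd ⊢
    refine (hd.eq_of_le h.isLine_d ?_).symm
    rw [h.d_line, e5, e6]
    exact span_pair_le (Submodule.smul_mem _ _ left_mem_span_pair)
      (Submodule.smul_mem _ _ right_mem_span_pair)
  exact Prod.ext h1 h2

/-- Three corners of a quadrilateral and a plane through the third line containing the fourth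
point determine the fourth corner. -/
theorem eq_of_plane (h : QuadFrame a b c d F G H N l m)
    (h' : QuadFrame a b c d' F' G' H' N' l' m') {P : Sub K} (hP : finrank K P ≤ 3)
    (hc : c.2 ≤ P) (hd : d.1 ≤ P) (hd' : d'.1 ≤ P) : d = d' := by
  obtain ⟨r, hr, hF⟩ := h.a_scale h'
  obtain ⟨s, hs, hH⟩ := exists_smul_of_span_eq h.flip.F_ne (h'.b_pt.symm.trans h.b_pt)
  obtain ⟨t, ht, hN⟩ := exists_smul_of_span_eq h.flip'.F_ne (h'.c_pt.symm.trans h.c_pt)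
  obtain ⟨h1, h2, h3, h4⟩ := h.plane_cd hP hc hd
  rw [h'.d_pt, span_singleton_le] at hd'
  have e : F' - H' - N' = s • (F - H) + t • (F - N) - r • F := by
    rw [← hF, ← hH, ← hN]; module
  -- Modulo the plane P, both H and F - N vanish and F becomes N, so the point of d' reduces to (s -
  -- r)N.
  have h5 : (s - r) • N ∈ P := by
    have := P.sub_mem hd' (P.sub_mem (P.smul_mem (s + t - r) h1) (P.smul_mem s h3))
    convert this using 1
    rw [e]; module
  have hsr : s = r := by
    by_contra h0
    exact h4 ((Submodule.smul_mem_iff _ (sub_ne_zero.2 h0)).1 h5)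
  subst hsr
  refine h.eq_of_scale h' hF ?_ hN
  rw [hF] at hH
  linear_combination (norm := module) -hH

/-- This serves the corner (1, 1), where the point is prescribed and only the line has to be
determined. -/
theorem eq_of_point (h : QuadFrame a b c d F G H N l m)
    (h' : QuadFrame a b c d' F' G' H' N' l' m') (hd : d.1 = d'.1) : d = d' := by
  obtain ⟨r, hr, hF⟩ := h.a_scale h'
  obtain ⟨s, hs, hH⟩ := exists_smul_of_span_eq h.flip.F_ne (h'.b_pt.symm.trans h.b_pt)
  obtain ⟨t, ht, hN⟩ := exists_smul_of_span_eq h.flip'.F_ne (h'.c_pt.symm.trans h.c_pt)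
  obtain ⟨u, hu, hD⟩ := exists_smul_of_span_eq h.flip.flip'.F_ne
    (h'.d_pt.symm.trans (hd.symm.trans h.d_pt))
  have e : u • (F - H - N) = s • (F - H) + t • (F - N) - r • F := by
    rw [← hF, ← hH, ← hN, ← hD]; module
  obtain ⟨p1, p2, p3, p4⟩ := h.indep (u - s - t + r) 0 (s - u) (t - u)
    (by linear_combination (norm := module) e)
  have hsr : s = r := by linear_combination -p1 - p4
  subst hsr
  refine h.eq_of_scale h' hF ?_ hN
  rw [hF] at hH
  linear_combination (norm := module) -hH

/-- Two quadrilaterals on opposite sides of the edge `a, c` have the same point of the opposite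
net at `a`, if the osculating planes across that edge contain the lines at `a` and `c`. -/
theorem span_G_eq (h : QuadFrame a b c d F G H N l m)
    (h' : QuadFrame a e c e' F' G' H' N' l' m') {P Q : Sub K} (hP : finrank K P ≤ 3)
    (hQ : finrank K Q ≤ 3) (ha : a.2 ≤ P) (hb : b.1 ≤ P) (he : e.1 ≤ P) (hc : c.2 ≤ Q)
    (hd : d.1 ≤ Q) (he' : e'.1 ≤ Q) : span K {G'} = span K {G} := by
  obtain ⟨p1, p2, p3, p4⟩ := h.plane_ab hP ha hb
  obtain ⟨q1, q2, q3, q4⟩ := h.plane_cd hQ hc hd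
  obtain ⟨-, -, hH1, -⟩ := h'.plane_ab hP ha he
  obtain ⟨-, -, hH2, -⟩ := h'.plane_cd hQ hc he'
  obtain ⟨x, y, z, w, hH⟩ := h.indep.exists_coords H'
  -- The intersection of P and Q is spanned by G and H: N is not in P, and F, which agrees with N
  -- modulo Q, is not in Q. So H' has no N- and no F-component.
  have hw : w = 0 := by
    by_contra h0
    refine p4 ((Submodule.smul_mem_iff _ h0).1 ?_)
    have := P.sub_mem hH1 (P.add_mem (P.add_mem (P.smul_mem x p1) (P.smul_mem y p2))
      (P.smul_mem z p3))
    convert this using 1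
    rw [hH]; module
  subst hw
  have hx : x = 0 := by
    by_contra h0
    refine q4 ((Submodule.smul_mem_iff _ h0).1 ?_)
    have := Q.sub_mem hH2 (Q.add_mem (Q.add_mem (Q.smul_mem x q1) (Q.smul_mem y q2))
      (Q.smul_mem z q3))
    convert this using 1
    rw [hH]; module
  subst hx
  have hG : G' ∈ a.2 := h'.a_line ▸ right_mem_span_pair
  have hc' : G' - l' • H' ∈ c.2 := h'.c_line ▸ right_mem_span_pair
  rw [h.a_line] at hG
  rw [h.c_line] at hc'
  obtain ⟨s, t, hG'⟩ := mem_span_pair.1 hG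
  obtain ⟨u, v, e1⟩ := mem_span_pair.1 hc'
  rw [hH, ← hG'] at e1
  -- Vectors of c have opposite F- and N-coordinates. Here the N-coordinate is zero, hence so is the
  -- F-coordinate s.
  obtain ⟨k1, k2, k3, k4⟩ := h.indep (u - s) (v - t + l' * y) (l' * z - v * l) (-u)
    (by linear_combination (norm := module) e1)
  have hs : s = 0 := by linear_combination -k1 - k4
  subst hs
  have ht : t ≠ 0 := by
    rintro rfl
    exact h'.G_ne (by simp [← hG'])
  exact span_singleton_eq_of_smul ht (by rw [← hG']; module)

/-- If two quadrilaterals on opposite sides of the edge `a, b` have the same point of the opposite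
net at `a`, and the osculating plane across that edge contains the line at `a`, then the same is
true at `b`. -/
theorem line_b_le (h : QuadFrame a b c d F G H N l m)
    (h' : QuadFrame a b e e' F' G' H' N' l' m') (hG : span K {G'} = span K {G})
    (ha : a.2 ≤ e.1 ⊔ a.1 ⊔ c.1) : b.2 ≤ e'.1 ⊔ b.1 ⊔ d.1 := by
  obtain ⟨q, hq, hG⟩ := exists_smul_of_span_eq h.G_ne hG
  obtain ⟨r, hr, hF⟩ := exists_smul_of_span_eq h.F_ne (h'.a_pt.symm.trans h.a_pt)
  obtain ⟨s, hs, hH⟩ := exists_smul_of_span_eq h.flip.F_ne (h'.b_pt.symm.trans h.b_pt)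
  have h1 : G ∈ e.1 ⊔ a.1 ⊔ c.1 := ha (h.a_line ▸ right_mem_span_pair)
  rw [h'.c_pt, h.a_pt, h.c_pt, mem_sup_span] at h1
  obtain ⟨x, y, z, e1⟩ := h1
  have hx : x ≠ 0 := by
    rintro rfl
    have := (h.indep (y + z) (-1) 0 (-z) (by linear_combination (norm := module) e1)).2.1
    simp at this
  have hN : x • N' = (x * r + y + z) • F - z • N - G := by
    rw [hF] at e1
    linear_combination (norm := module) -e1
  have hb : G' - m' • N' ∈ b.2 := h'.b_line ▸ right_mem_span_pair
  rw [h.b_line] at hb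
  obtain ⟨u, v, e2⟩ := mem_span_pair.1 hb
  have e3 : (x * u) • (F - H) + (x * v) • (G - m • N) =
      (x * q) • G - m' • ((x * r + y + z) • F - z • N - G) := by
    rw [← hN]
    have := congrArg (x • ·) e2
    simp only [hG] at this
    linear_combination (norm := module) this
  obtain ⟨k1, k2, k3, k4⟩ := h.indep (x * u + m' * (x * r + y + z)) (x * v - x * q - m')
    (-(x * u)) (-(x * v * m) - m' * z) (by linear_combination (norm := module) e3)
  -- Vectors of b have opposite F- and H-coordinates, and the right side of `e3` has no H-term. Thus
  -- xN' = -zN - G.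
  have h0 : x * r + y + z = 0 := by
    have : m' * (x * r + y + z) = 0 := by linear_combination k1 + k3
    simpa [h'.m_ne] using this
  rw [h0] at hN
  rw [h.b_line]
  have hD : F' - H' - N' = s • (F - H) - N' := by rw [hH]
  refine span_pair_le ?_ ?_
  · rw [h.b_pt]
    exact mem_sup_left (mem_sup_right (mem_span_singleton_self _))
  · rw [h'.d_pt, h.b_pt, h.d_pt, mem_sup_span]
    -- The coefficients eliminate F - H, leaving -xN' - (z + m)N = G - mN.
    refine ⟨x, -(x * s) - (z + m), z + m, ?_⟩
    rw [hD]
    linear_combination (norm := module) -hN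

end QuadFrame
end Steps

/-! ### Reguli as graphs of proportional isomorphisms, and the existence of normal forms. -/

section Reguli

variable {K : Type*} [Field K]

theorem left_mem_regulus {A B C : Sub K} (hA : IsLine A) : A ∈ regulus A B C :=
  ⟨hA, fun _ _ h _ _ => h⟩

theorem middle_mem_regulus {A B C : Sub K} (hB : IsLine B) : B ∈ regulus A B C :=
  ⟨hB, fun _ _ _ h _ => h⟩

theorem Skew.exists_add {A B : Sub K} (hA : IsLine A) (hB : IsLine B) (h : Skew A B)
    (v : Fin 4 → K) : ∃ y ∈ A, ∃ z ∈ B, v = y + z := by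
  obtain ⟨a, b, hab, rfl⟩ := hA.exists_basis
  obtain ⟨c, d, hcd, rfl⟩ := hB.exists_basis
  obtain ⟨x, y, z, w, rfl⟩ := (h.indep4 hab hcd).exists_coords v
  exact ⟨x • a + y • b, mem_span_pair.2 ⟨x, y, rfl⟩, z • c + w • d, mem_span_pair.2 ⟨z, w, rfl⟩,
    by module⟩

/-- A line of the regulus of `A, B, C` is the graph of a multiple of the isomorphism from `A` to
`B` with graph `C`. -/
theorem exists_ratio_of_mem_regulus {A B C D : Sub K} (hAB : Skew A B) (hAC : Skew A C)
    (hAD : Skew A D) (hBD : Skew B D) (hCD : Skew C D) (hD : D ∈ regulus A B C)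
    {a₁ a₂ b₁ b₂ : Fin 4 → K} (ha : Indep2 a₁ a₂) (ha₁ : a₁ ∈ A) (ha₂ : a₂ ∈ A) (hb₁ : b₁ ∈ B)
    (hb₂ : b₂ ∈ B) (hc₁ : a₁ + b₁ ∈ C) (hc₂ : a₂ + b₂ ∈ C) :
    Indep2 b₁ b₂ ∧ ∃ r : K, r ≠ 0 ∧ r ≠ 1 ∧ a₁ + r • b₁ ∈ D ∧ a₂ + r • b₂ ∈ D := by
  have hb : Indep2 b₁ b₂ := fun s t e => by
    have hc := C.add_mem (C.smul_mem s hc₁) (C.smul_mem t hc₂)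
    rw [show s • (a₁ + b₁) + t • (a₂ + b₂) = s • a₁ + t • a₂ + (s • b₁ + t • b₂) by module, e,
      add_zero] at hc
    exact ha _ _ (skew_iff.1 hAC _ (A.add_mem (A.smul_mem s ha₁) (A.smul_mem t ha₂)) hc)
  -- If v is the image of u under the isomorphism with graph C, the line spanned by u and v is a
  -- common transversal, so D meets it in some u + rv.
  have key : ∀ u ∈ A, ∀ v ∈ B, u ≠ 0 → v ≠ 0 → u + v ∈ C → ∃ r : K, u + r • v ∈ D := by
    intro u hu v hv hu0 hv0 hw
    have hI := hAB.indep2 hu hv hu0 hv0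
    have hw0 : u + v ≠ 0 := fun h0 => by
      simpa using (hI 1 1 (by simpa using h0)).1
    obtain ⟨z, hz, hzD, hz0⟩ := meets_iff.1 (hD.2 _ hI.isLine
      (meets_iff.2 ⟨u, left_mem_span_pair, hu, hu0⟩)
      (meets_iff.2 ⟨v, right_mem_span_pair, hv, hv0⟩)
      (meets_iff.2 ⟨u + v, mem_span_pair.2 ⟨1, 1, by module⟩, hw, hw0⟩))
    obtain ⟨s, t, rfl⟩ := mem_span_pair.1 hz
    have hs : s ≠ 0 := by
      rintro rfl
      rw [zero_smul, zero_add] at hzD hz0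
      exact hz0 (skew_iff.1 hBD _ (B.smul_mem t hv) hzD)
    refine ⟨s⁻¹ * t, ?_⟩
    have := D.smul_mem s⁻¹ hzD
    rwa [smul_add, smul_smul, smul_smul, inv_mul_cancel₀ hs, one_smul] at this
  obtain ⟨r₁, h₁⟩ := key a₁ ha₁ b₁ hb₁ ha.ne_zero_left hb.ne_zero_left hc₁
  obtain ⟨r₂, h₂⟩ := key a₂ ha₂ b₂ hb₂ ha.ne_zero_right hb.ne_zero_right hc₂
  obtain ⟨r₃, h₃⟩ := key (a₁ + a₂) (A.add_mem ha₁ ha₂) (b₁ + b₂) (B.add_mem hb₁ hb₂)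
    (fun h0 => by simpa using (ha 1 1 (by simpa using h0)).1)
    (fun h0 => by simpa using (hb 1 1 (by simpa using h0)).1)
    (by rw [add_add_add_comm]; exact C.add_mem hc₁ hc₂)
  -- Comparing the ratio at the sum of the basis vectors with the ratios at both shows that they
  -- agree.
  have h0 : (r₃ - r₁) • b₁ + (r₃ - r₂) • b₂ = 0 := by
    refine skew_iff.1 hBD _ (B.add_mem (B.smul_mem _ hb₁) (B.smul_mem _ hb₂)) ?_
    convert D.sub_mem h₃ (D.add_mem h₁ h₂) using 1
    module
  obtain ⟨e₁, e₂⟩ := hb _ _ h0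
  obtain rfl : r₁ = r₂ := by linear_combination e₂ - e₁
  refine ⟨hb, r₁, ?_, ?_, h₁, h₂⟩
  · rintro rfl
    rw [zero_smul, add_zero] at h₁
    exact ha.ne_zero_left (skew_iff.1 hAD _ ha₁ h₁)
  · rintro rfl
    rw [one_smul] at h₁
    have h4 := skew_iff.1 hCD _ hc₁ h₁
    refine ha.ne_zero_left (skew_iff.1 hAB _ ha₁ ?_)
    rw [eq_neg_of_add_eq_zero_left h4]
    exact B.neg_mem hb₁

theorem exists_ratio_of_mem_regulus' {A B C D : Sub K} (hA : IsLine A) (hB : IsLine B)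
    (hC : IsLine C) (hAB : Skew A B) (hAC : Skew A C) (hBC : Skew B C) (hAD : Skew A D)
    (hBD : Skew B D) (hCD : Skew C D) (hD : D ∈ regulus A B C) {u : Fin 4 → K} (hu : u ∈ A)
    (hu0 : u ≠ 0) :
    ∃ v ∈ B, u + v ∈ C ∧ ∃ r : K, r ≠ 0 ∧ r ≠ 1 ∧ u + r • v ∈ D := by
  obtain ⟨w, hw, hAw⟩ := hA.exists_right hu hu0
  have hwA : w ∈ A := hAw ▸ right_mem_span_pair
  obtain ⟨b₁, hb₁, c₁, hc₁, e₁⟩ := hBC.exists_add hB hC u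
  obtain ⟨b₂, hb₂, c₂, hc₂, e₂⟩ := hBC.exists_add hB hC w
  have h1 : u + -b₁ ∈ C := by rw [e₁]; convert hc₁ using 1; abel
  have h2 : w + -b₂ ∈ C := by rw [e₂]; convert hc₂ using 1; abel
  obtain ⟨-, r, h0, h3, h4, -⟩ := exists_ratio_of_mem_regulus hAB hAC hAD hBD hCD hD hw hu hwA
    (B.neg_mem hb₁) (B.neg_mem hb₂) h1 h2
  exact ⟨-b₁, B.neg_mem hb₁, h1, r, h0, h3, h4⟩

/-- Four pairwise skew lines of a regulus with coplanar points on them, no three of which are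
collinear, are the corners of a quadrilateral in normal form. -/
theorem exists_quadFrame {a b c d : Flag K} {va vb vc vd : Fin 4 → K}
    (ha : a.1 = span K {va}) (hb : b.1 = span K {vb}) (hc : c.1 = span K {vc})
    (hd : d.1 = span K {vd}) (hva : va ∈ a.2) (hvb : vb ∈ b.2) (hvc : vc ∈ c.2) (hvd : vd ∈ d.2)
    (hvd0 : vd ≠ 0)
    (hA : IsLine a.2) (hB : IsLine b.2) (hC : IsLine c.2)
    (hAB : Skew a.2 b.2) (hAC : Skew a.2 c.2) (hBC : Skew b.2 c.2) (hAD : Skew a.2 d.2)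
    (hBD : Skew b.2 d.2) (hCD : Skew c.2 d.2) (hD : d.2 ∈ regulus a.2 b.2 c.2)
    {α β γ : K} (hα : α ≠ 0) (hβ : β ≠ 0) (hγ : γ ≠ 0) (e : vd = α • va + β • vb + γ • vc)
    (hne : ∀ u v : Fin 4 → K, va ∈ span K {u, v} → vb ∈ span K {u, v} → vc ∈ span K {u, v} →
      vd ∈ span K {u, v} → False) :
    ∃ F G H N l m, QuadFrame a b c d F G H N l m := by
  obtain ⟨a₁, ha₁, b₁, hb₁, e₁⟩ := hAB.exists_add hA hB (γ • vc)
  obtain ⟨y, hy, z, hz, e₂⟩ := hAB.exists_add hA hB vd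
  -- Everything is split along A ⊕ B; comparing components in `e` yields α va = y - a₁ and β vb = z
  -- - b₁.
  have hc₁ : a₁ + b₁ ∈ c.2 := e₁ ▸ Submodule.smul_mem _ _ hvc
  have hsub : α • va + a₁ - y = 0 := by
    refine skew_iff.1 hAB _ (Submodule.sub_mem _ (Submodule.add_mem _ (Submodule.smul_mem _ _ hva)
      ha₁) hy) ?_
    have h1 : α • va + a₁ - y = z - b₁ - β • vb := by
      linear_combination (norm := module) e₂ - e - e₁
    rw [h1]
    exact Submodule.sub_mem _ (Submodule.sub_mem _ hz hb₁) (Submodule.smul_mem _ _ hvb)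
  have hvae : α • va = y - a₁ := by linear_combination (norm := module) hsub
  have hvbe : β • vb = z - b₁ := by linear_combination (norm := module) e₂ - e - e₁ - hsub
  have hy0 : y ≠ 0 := by
    rintro rfl
    rw [zero_add] at e₂
    exact hvd0 (skew_iff.1 hBD _ (e₂ ▸ hz) hvd)
  -- Here b₂ is the image of y under the isomorphism with graph C. Independence of y and a₁ is not
  -- yet known, so the ratio is first taken along y alone.
  obtain ⟨b₂, hb₂, hc₂, q, -, -, hq⟩ :=
    exists_ratio_of_mem_regulus' hA hB hC hAB hAC hBC hAD hBD hCD hD hy hy0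
  have unsm : ∀ {P : Sub K} {r : K} {v : Fin 4 → K}, r ≠ 0 → r • v ∈ P → v ∈ P :=
    fun hr h => (Submodule.smul_mem_iff _ hr).1 h
  -- If a₁ is a multiple of y, all four points lie on the transversal spanned by y and b₂, against
  -- `hne`.
  have hI : Indep2 y a₁ := by
    refine indep2_of_notMem hy0 fun hm => ?_
    obtain ⟨r, rfl⟩ := mem_span_singleton.1 hm
    have hz' : z - q • b₂ = 0 := by
      refine skew_iff.1 hBD _ (Submodule.sub_mem _ hz (Submodule.smul_mem _ _ hb₂)) ?_
      convert Submodule.sub_mem _ hvd hq using 1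
      rw [e₂]; module
    have hb' : b₁ - r • b₂ = 0 := by
      have h1 : b₁ - r • b₂ ∈ b.2 := Submodule.sub_mem _ hb₁ (Submodule.smul_mem _ _ hb₂)
      refine skew_iff.1 hBC _ h1 ?_
      convert Submodule.sub_mem _ hc₁ (Submodule.smul_mem _ r hc₂) using 1
      module
    have hz'' : z = q • b₂ := by linear_combination (norm := module) hz'
    have hb'' : b₁ = r • b₂ := by linear_combination (norm := module) hb'
    refine hne y b₂ (unsm hα (mem_span_pair.2 ⟨1 - r, 0, ?_⟩))
      (unsm hβ (mem_span_pair.2 ⟨0, q - r, ?_⟩)) (unsm hγ (mem_span_pair.2 ⟨r, r, ?_⟩))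
      (mem_span_pair.2 ⟨1, q, ?_⟩)
    · rw [hvae]; module
    · rw [hvbe, hz'', hb'']; module
    · rw [e₁, hb'']
    · rw [e₂, hz'']; module
  obtain ⟨hJ, q, hq0, hq1, hqy, hqa⟩ := exists_ratio_of_mem_regulus hAB hAC hAD hBD hCD hD hI hy ha₁
    hb₂ hb₁ hc₂ hc₁
  have hz' : z - q • b₂ = 0 := by
    refine skew_iff.1 hBD _ (Submodule.sub_mem _ hz (Submodule.smul_mem _ _ hb₂)) ?_
    convert Submodule.sub_mem _ hvd hqy using 1
    rw [e₂]; module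
  have hz'' : z = q • b₂ := by linear_combination (norm := module) hz'
  have hsk := hAB
  rw [hA.eq_span hI hy ha₁, hB.eq_span hJ hb₂ hb₁] at hsk
  have h4 := hsk.indep4 hI hJ
  have hq1' : 1 - q ≠ 0 := sub_ne_zero.2 hq1.symm
  have hF : Indep4 (a₁ - y) (-(1 - q) • y) (a₁ - y + b₁ - q • b₂) (-y - b₁) := by
    intro x1 x2 x3 x4 h0
    obtain ⟨k1, k2, k3, k4⟩ := h4 (-x1 - x2 * (1 - q) - x3 - x4) (x1 + x3) (-x3 * q) (x3 - x4)
      (by linear_combination (norm := module) h0)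
    have hx3 : x3 = 0 := by simpa [hq0] using k3
    subst hx3
    have hx4 : x4 = 0 := by simpa using k4
    have hx1 : x1 = 0 := by simpa using k2
    subst hx4 hx1
    have hx2 : x2 = 0 := by simpa [hq1'] using k1
    exact ⟨rfl, hx2, rfl, rfl⟩
  have aux : ∀ {r : K} {u v : Fin 4 → K}, r ≠ 0 → v = r • u → span K {u} = span K {v} :=
    fun hr h => (span_singleton_eq_of_smul hr h).symm
  have line : ∀ {L : Sub K} {u v : Fin 4 → K}, IsLine L → u ∈ L → v ∈ L → Indep2 u v →
    L = span K {u, v} := fun hL hu hv h => hL.eq_span h hu hv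
  -- The points dictate F - H = β vb, F - N = γ vc and F - H - N = vd, hence F = -α va and then H
  -- and N. With l = 1, membership of G - H in C forces G = -(1 - q)y, and m = 1 - q makes the
  -- A-component of G - mN vanish.
  refine ⟨a₁ - y, -(1 - q) • y, a₁ - y + b₁ - q • b₂, -y - b₁, 1, 1 - q, hF, one_ne_zero, hq1',
    ?_, ?_, ?_, ?_, ?_, ?_, ?_, ?_⟩
  · rw [ha]
    exact aux (neg_ne_zero.2 hα) (by rw [neg_smul, hvae]; module)
  · rw [hb]
    exact aux hβ (by rw [hvbe, hz'']; module)
  · rw [hc]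
    exact aux hγ (by rw [e₁]; module)
  · rw [hd]
    exact aux (r := 1) one_ne_zero (by rw [e₂, hz'']; module)
  · refine line hA (Submodule.sub_mem _ ha₁ hy) (Submodule.smul_mem _ _ hy) fun s t h0 => ?_
    obtain ⟨k1, k2, -, -⟩ := hF s t 0 0 (by linear_combination (norm := module) h0)
    exact ⟨k1, k2⟩
  · refine line hB ?_ ?_ fun s t h0 => ?_
    · convert Submodule.neg_mem _ (Submodule.sub_mem _ hb₁ (Submodule.smul_mem _ q hb₂)) using 1
      module
    · convert Submodule.smul_mem _ (1 - q) hb₁ using 1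
      module
    · obtain ⟨k1, k2, -, -⟩ := hF s t (-s) (-(t * (1 - q)))
        (by linear_combination (norm := module) h0)
      exact ⟨k1, k2⟩
  · refine line hC ?_ ?_ fun s t h0 => ?_
    · convert hc₁ using 1
      module
    · convert Submodule.sub_mem _ (Submodule.smul_mem _ q hc₂) hc₁ using 1
      module
    · obtain ⟨k1, k2, -, -⟩ := hF s t (-t) (-s) (by linear_combination (norm := module) h0)
      exact ⟨k1, k2⟩
  · refine line hD.1 ?_ ?_ fun s t h0 => ?_
    · convert hqy using 1
      module
    · convert Submodule.sub_mem _ hqy hqa using 1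
      module
    · obtain ⟨k1, k2, -, -⟩ := hF s t (-s - t) (-s - t * (1 - q))
        (by linear_combination (norm := module) h0)
      exact ⟨k1, k2⟩

end Reguli

/-! ### From a successful projection step to a normal form. -/

section SingleSteps

variable {K : Type*} [Field K]

theorem Pt.ne_of_skew {x y : Pt K} {L M : Sub K} (h : Skew L M) (hx : x.submodule ≤ L)
    (hy : y.submodule ≤ M) : x ≠ y := by
  rintro rfl
  obtain ⟨v, hv, e⟩ := Pt.exists_vec x
  rw [e, span_singleton_le] at hx hy
  exact hv (skew_iff.1 h v hx hy)

theorem Pt.not_le_of_skew {x : Pt K} {L M : Sub K} (h : Skew L M) (hx : x.submodule ≤ L) :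
    ¬ x.submodule ≤ M := by
  intro hy
  exact Pt.ne_of_skew h hx hy rfl

theorem Pt.exchange {x y z : Pt K} (h : x.submodule ≤ y.submodule ⊔ z.submodule) (hne : x ≠ y) :
    z.submodule ≤ y.submodule ⊔ x.submodule := by
  obtain ⟨vx, hx, ex⟩ := Pt.exists_vec x
  obtain ⟨vy, hy, ey⟩ := Pt.exists_vec y
  obtain ⟨vz, hz, ez⟩ := Pt.exists_vec z
  rw [ex, ey, ez, span_sup_span, span_singleton_le, mem_span_pair] at h
  obtain ⟨s, t, e⟩ := h
  have ht : t ≠ 0 := by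
    rintro rfl
    refine hne (Pt.eq_of_le ?_)
    rw [ex, ey, span_singleton_le, mem_span_singleton]
    exact ⟨s, by rw [← e]; module⟩
  rw [ex, ey, ez, span_sup_span, span_singleton_le]
  refine (Submodule.smul_mem_iff _ ht).1 (mem_span_pair.2 ⟨-s, 1, ?_⟩)
  rw [← e]; module

/-- The span of a line and a point outside of it is determined as a plane containing both. -/
theorem plane_eq {A P Q : Sub K} {x : Pt K} (hA : IsLine A) (hx : ¬ x.submodule ≤ A)
    (hP : finrank K P ≤ 3) (hQ : finrank K Q ≤ 3) (hAP : A ≤ P) (hAQ : A ≤ Q)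
    (hxP : x.submodule ≤ P) (hxQ : x.submodule ≤ Q) : P = Q := by
  have h3 : 3 ≤ finrank K (x.submodule ⊔ A : Sub K) := by
    have : finrank K A < finrank K (x.submodule ⊔ A : Sub K) := by
      apply finrank_lt_finrank_of_lt
      refine lt_of_le_of_ne le_sup_right fun h => hx ?_
      rw [h]; exact le_sup_left
    unfold IsLine at hA
    omega
  have key : ∀ R : Sub K, finrank K R ≤ 3 → A ≤ R → x.submodule ≤ R → x.submodule ⊔ A = R :=
    fun R hR h1 h2 => eq_of_le_of_finrank_le (sup_le h2 h1) (hR.trans h3)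
  exact (key P hP hAP hxP).symm.trans (key Q hQ hAQ hxQ)

/-- Four pairwise skew lines of a regulus with a point on each. -/
structure RegulusQuad (pa pb pc pd : Pt K) (A B C D : Sub K) : Prop where
  line_a : IsLine A
  line_b : IsLine B
  line_c : IsLine C
  skew_ab : Skew A B
  skew_ac : Skew A C
  skew_bc : Skew B C
  skew_ad : Skew A D
  skew_bd : Skew B D
  skew_cd : Skew C D
  mem_a : pa.submodule ≤ A
  mem_b : pb.submodule ≤ B
  mem_c : pc.submodule ≤ C
  mem_d : pd.submodule ≤ D
  regulus : D ∈ regulus A B C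

variable {pa pb pc pd : Pt K} {A B C D x : Sub K}

theorem RegulusQuad.exists_quadFrame (h : RegulusQuad pa pb pc pd A B C D)
    (hπ : pd.submodule ≤ pa.submodule ⊔ pb.submodule ⊔ pc.submodule)
    (h₁ : ¬ pd.submodule ≤ pb.submodule ⊔ pc.submodule)
    (h₂ : ¬ pd.submodule ≤ pa.submodule ⊔ pc.submodule)
    (h₃ : ¬ pd.submodule ≤ pa.submodule ⊔ pb.submodule)
    (hne : ∀ L : Sub K, finrank K L ≤ 2 → pa.submodule ≤ L → pb.submodule ≤ L →
      pc.submodule ≤ L → pd.submodule ≤ L → False) :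
    ∃ F G H N l m, QuadFrame (pa.submodule, A) (pb.submodule, B) (pc.submodule, C)
      (pd.submodule, D) F G H N l m := by
  obtain ⟨va, ha, ea⟩ := Pt.exists_vec pa
  obtain ⟨vb, hb, eb⟩ := Pt.exists_vec pb
  obtain ⟨vc, hc, ec⟩ := Pt.exists_vec pc
  obtain ⟨vd, hd, ed⟩ := Pt.exists_vec pd
  have hma := h.mem_a
  have hmb := h.mem_b
  have hmc := h.mem_c
  have hmd := h.mem_d
  simp only [ea, eb, ec, ed, span_singleton_le] at *
  rw [mem_sup_span] at hπ
  obtain ⟨α, β, γ, e⟩ := hπ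
  rw [span_sup_span] at h₁ h₂ h₃
  refine LaplaceCycles.exists_quadFrame (a := (span K {va}, A)) (b := (span K {vb}, B))
    (c := (span K {vc}, C)) (d := (span K {vd}, D)) rfl rfl rfl rfl hma hmb hmc hmd hd
    h.line_a h.line_b h.line_c h.skew_ab h.skew_ac h.skew_bc h.skew_ad h.skew_bd h.skew_cd
    h.regulus (α := α) (β := β) (γ := γ) ?_ ?_ ?_ e.symm
    (fun u v => hne _ finrank_span_pair_le)
  · rintro rfl
    exact h₁ (mem_span_pair.2 ⟨β, γ, by rw [← e]; module⟩)
  · rintro rfl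
    exact h₂ (mem_span_pair.2 ⟨α, γ, by rw [← e]; module⟩)
  · rintro rfl
    exact h₃ (mem_span_pair.2 ⟨α, β, by rw [← e]; module⟩)

/-- The join of an empty family would be zero, so some line of the regulus passes through y;
contained in the line D, it equals D. -/
theorem regulusLine_spec {y : Sub K} (hD : IsLine D) (h : regulusLine A B C y = D) :
    D ∈ regulus A B C ∧ y ≤ D := by
  obtain ⟨L, hL⟩ : {L | L ∈ regulus A B C ∧ y ≤ L}.Nonempty := by
    rw [Set.nonempty_iff_ne_empty]
    intro h0
    unfold regulusLine at h
    rw [h0, sSup_empty] at h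
    exact hD.ne_bot h.symm
  have : L ≤ D := h ▸ le_sSup hL
  rwa [← hL.1.1.eq_of_le hD this]

/-- If the join of all candidate points is a single point, candidates exist and all coincide with
it. This uniqueness is what a construction without singularities supplies. -/
theorem conicProjection_spec {π z : Sub K} (h : conicProjection A B C π z x = pd.submodule) :
    (pd.submodule ≤ π ∧ pd.submodule ≤ x ⊔ C) ∧
    ∀ y : Pt K, y ∈ quadric A B C → y.submodule ≤ π → y.submodule ≤ x ⊔ C → y.submodule ≠ z →
      y = pd := by
  have key : ∀ y : Pt K, y ∈ quadric A B C → y.submodule ≤ π → y.submodule ≤ x ⊔ C →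
      y.submodule ≠ z → y = pd := fun y h1 h2 h3 h4 =>
    Pt.eq_of_le (h ▸ le_sSup ⟨y, h1, h2, h3, h4, rfl⟩)
  refine ⟨?_, key⟩
  obtain ⟨S, y, h1, h2, h3, h4, -⟩ : {S | ∃ y : Pt K, y ∈ quadric A B C ∧ y.submodule ≤ π ∧
      y.submodule ≤ x ⊔ C ∧ y.submodule ≠ z ∧ S = y.submodule}.Nonempty := by
    rw [Set.nonempty_iff_ne_empty]
    intro h0
    unfold conicProjection at h
    rw [h0, sSup_empty] at h
    have := Pt.finrank pd
    rw [← h] at this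
    simp at this
  rw [← key y h1 h2 h3 h4]
  exact ⟨h2, h3⟩

/-- If a projection step produces a point and a line that is skew to the other three, then
the quadrilateral has a normal form. -/
theorem exists_quadFrame_of_nextFlag (hA : IsLine A) (hB : IsLine B) (hC : IsLine C)
    (hD : IsLine D) (hAB : Skew A B) (hAC : Skew A C) (hBC : Skew B C) (hAD : Skew A D)
    (hBD : Skew B D) (hCD : Skew C D) (ha : pa.submodule ≤ A) (hb : pb.submodule ≤ B)
    (hc : pc.submodule ≤ C)
    (h : nextFlag (pa.submodule, A) (pb.submodule, B) (pc.submodule, C) x = (pd.submodule, D))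
    (hne : ∀ L : Sub K, finrank K L ≤ 2 → pa.submodule ≤ L → pb.submodule ≤ L →
      pc.submodule ≤ L → pd.submodule ≤ L → False) :
    pd.submodule ≤ D ∧ pd.submodule ≤ x ⊔ C ∧
    ∃ F G H N l m, QuadFrame (pa.submodule, A) (pb.submodule, B) (pc.submodule, C)
      (pd.submodule, D) F G H N l m := by
  unfold nextFlag at h
  simp only [Prod.mk.injEq] at h
  obtain ⟨hp, hL⟩ := h
  rw [hp] at hL
  obtain ⟨hreg, hd⟩ := regulusLine_spec hD hL
  obtain ⟨⟨hπ, hx⟩, huniq⟩ := conicProjection_spec hp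
  have hcx : pc.submodule ≤ x ⊔ C := hc.trans le_sup_right
  have hdc : pd ≠ pc := Pt.ne_of_skew hCD.symm hd hc
  -- Otherwise the point of a would itself be a candidate of the projection and coincide with d,
  -- although A and D are skew. The same applies to b.
  have nota : ¬ pa.submodule ≤ x ⊔ C := fun h1 =>
    Pt.ne_of_skew hAD ha hd (huniq pa ⟨A, left_mem_regulus hA, ha⟩
      (le_sup_left.trans le_sup_left) h1 fun e =>
        Pt.ne_of_skew hAC ha hc (Projectivization.submodule_injective e))
  have notb : ¬ pb.submodule ≤ x ⊔ C := fun h1 =>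
    Pt.ne_of_skew hBD hb hd (huniq pb ⟨B, middle_mem_regulus hB, hb⟩
      (le_sup_right.trans le_sup_left) h1 fun e =>
        Pt.ne_of_skew hBC hb hc (Projectivization.submodule_injective e))
  refine ⟨hd, hx, RegulusQuad.exists_quadFrame ⟨hA, hB, hC, hAB, hAC, hBC, hAD, hBD, hCD, ha, hb,
    hc, hd, hreg⟩ hπ (fun h1 => notb ?_) (fun h1 => nota ?_) (fun h1 => nota ?_) hne⟩
  · rw [sup_comm] at h1
    exact (Pt.exchange h1 hdc).trans (sup_le hcx hx)
  · rw [sup_comm] at h1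
    exact (Pt.exchange h1 hdc).trans (sup_le hcx hx)
  -- If d is on the line ab, that line meets A, B and D, hence is a transversal meeting C as well.
  -- Its points on C and D differ since r ≠ 1 and lie in the plane of projection, so a would lie
  -- there too.
  · obtain ⟨va, hva, ea⟩ := Pt.exists_vec pa
    obtain ⟨vb, hvb, eb⟩ := Pt.exists_vec pb
    obtain ⟨vd, hvd, ed⟩ := Pt.exists_vec pd
    rw [ea, span_singleton_le] at ha
    rw [eb, span_singleton_le] at hb
    rw [ed, span_singleton_le] at hd hx
    rw [ea, eb, ed, span_singleton_le, span_sup_span] at h1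
    obtain ⟨α, β, e⟩ := mem_span_pair.1 h1
    obtain ⟨v, hv, hvC, r, hr0, hr1, hvD⟩ :=
      exists_ratio_of_mem_regulus' hA hB hC hAB hAC hBC hAD hBD hCD hreg ha hva
    have h0 : β • vb - (α * r) • v = 0 := by
      refine skew_iff.1 hBD _ (B.sub_mem (B.smul_mem _ hb) (B.smul_mem _ hv)) ?_
      convert D.sub_mem hd (D.smul_mem α hvD) using 1
      rw [← e]; module
    have hα : α ≠ 0 := by
      rintro rfl
      refine hvd (skew_iff.1 hBD _ ?_ hd)
      rw [← e, zero_smul, zero_add]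
      exact B.smul_mem _ hb
    have h2 : (α * (1 - r)) • va = vd - (α * r) • (va + v) := by
      linear_combination (norm := module) e - h0
    rw [ea, span_singleton_le]
    refine (Submodule.smul_mem_iff _ (mul_ne_zero hα (sub_ne_zero.2 hr1.symm))).1 ?_
    rw [h2]
    exact Submodule.sub_mem _ hx (Submodule.smul_mem _ _ (le_sup_right (α := Sub K) hvC))

end SingleSteps

/-! ### Combinatorics of the construction on ℤ². -/

section Grid

variable {K : Type*} [Field K]

/-- Two consecutive values propagate outwards; s is the outward direction, so the first downward
step starts at 0 and looks back to 1. -/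
theorem int_induction_two {Q : ℤ → Prop} (h0 : Q 0) (h1 : Q 1)
    (hs : ∀ i s : ℤ, 1 ≤ i ∧ s = 1 ∨ i ≤ 0 ∧ s = -1 → Q i → Q (i - s) → Q (i + s)) :
    ∀ i, Q i := by
  have up : ∀ n : ℕ, Q n ∧ Q (n + 1) := by
    intro n
    induction n with
    | zero => exact ⟨by simpa using h0, by simpa using h1⟩
    | succ n ih =>
      refine ⟨by simpa using ih.2, ?_⟩
      have := hs (n + 1) 1 (Or.inl ⟨by omega, rfl⟩) ih.2 (by simpa using ih.1)
      simpa using this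
  have down : ∀ n : ℕ, Q (-n) ∧ Q (-n + 1) := by
    intro n
    induction n with
    | zero => exact ⟨by simpa using h0, by simpa using h1⟩
    | succ n ih =>
      have := hs (-n) (-1) (Or.inr ⟨by omega, rfl⟩) ih.1 (by simpa using ih.2)
      refine ⟨by convert this using 1; push_cast; ring, ?_⟩
      convert ih.1 using 1; push_cast; ring
  intro i
  obtain ⟨n, rfl | rfl⟩ := i.eq_nat_or_neg
  · exact (up n).1
  · exact (down n).1

theorem int_induction_rows {Q : ℤ → Prop} (h0 : Q 0)
    (hs : ∀ j t : ℤ, 0 ≤ j ∧ t = 1 ∨ j ≤ 0 ∧ t = -1 → Q j → Q (j + t)) : ∀ j, Q j := by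
  intro j
  induction j with
  | zero => exact h0
  | succ n ih => exact hs n 1 (Or.inl ⟨by omega, rfl⟩) ih
  | pred n ih => exact hs (-n) (-1) (Or.inr ⟨by omega, rfl⟩) ih

/-- Induction along the order of the construction. -/
theorem grid_induction {P : ℤ → ℤ → Prop} (hx : ∀ i, P i 0) (hy : ∀ j, P 0 j) (h11 : P 1 1)
    (col : ∀ j t : ℤ, 1 ≤ j ∧ t = 1 ∨ j ≤ 0 ∧ t = -1 → P 0 j → P 0 (j + t) → P 1 j →
      P 1 (j - t) → P 1 (j + t))
    (row : ∀ i j s t : ℤ, 1 ≤ i ∧ s = 1 ∨ i ≤ 0 ∧ s = -1 → 0 ≤ j ∧ t = 1 ∨ j ≤ 0 ∧ t = -1 →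
      P i j → P (i + s) j → P i (j + t) → P (i - s) (j + t) → P (i + s) (j + t)) :
    ∀ i j, P i j := by
  -- Column 1 comes first because each row needs two initial values.
  have h1 : ∀ j, P 1 j := int_induction_two (hx 1) h11
    fun j t ht h1 h2 => col j t ht (hy _) (hy _) h1 h2
  have : ∀ j i, P i j := int_induction_rows hx fun j t ht ih =>
    int_induction_two (hy _) (h1 _) fun i s hs h1 h2 => row i j s t hs ht (ih _) (ih _) h1 h2
  exact fun i j => this j i

theorem extend_zero (rail : ℤ → Flag K) (s₀ s₁ : Flag K) : extend rail s₀ s₁ 0 = s₀ := by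
  simp [extend, ray]

theorem extend_one (rail : ℤ → Flag K) (s₀ s₁ : Flag K) : extend rail s₀ s₁ 1 = s₁ := by
  simp [extend, ray]

theorem extend_of_nat (rail : ℤ → Flag K) (s₀ s₁ : Flag K) (n : ℕ) :
    extend rail s₀ s₁ n = ray rail s₀ s₁ n := by
  simp [extend]

/-- The reflection n ↦ 1 - n turns the downward ray into an upward one; the two descriptions overlap
at 0 and 1. -/
theorem extend_one_sub_nat (rail : ℤ → Flag K) (s₀ s₁ : Flag K) (n : ℕ) :
    extend rail s₀ s₁ (1 - n) = ray (fun n => rail (1 - n)) s₁ s₀ n := by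
  rcases n with _ | _ | n
  · simp [extend, ray]
  · simp [extend, ray]
  · rw [extend, if_neg (by push_cast; omega)]
    congr
    push_cast
    omega

theorem extend_step (rail : ℤ → Flag K) (s₀ s₁ : Flag K) {i s : ℤ}
    (h : 1 ≤ i ∧ s = 1 ∨ i ≤ 0 ∧ s = -1) :
    extend rail s₀ s₁ (i + s) = nextFlag (rail i) (rail (i + s)) (extend rail s₀ s₁ i)
      (extend rail s₀ s₁ (i - s)).1 := by
  rcases h with ⟨hi, rfl⟩ | ⟨hi, rfl⟩
  · obtain ⟨n, rfl⟩ : ∃ n : ℕ, i = ((n + 1 : ℕ) : ℤ) := ⟨(i - 1).toNat, by omega⟩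
    have e1 : ((n + 1 : ℕ) : ℤ) + 1 = ((n + 2 : ℕ) : ℤ) := by push_cast; ring
    have e2 : ((n + 1 : ℕ) : ℤ) - 1 = ((n : ℕ) : ℤ) := by push_cast; ring
    rw [e1, e2, extend_of_nat, extend_of_nat, extend_of_nat, ray]
    push_cast
    rfl
  · obtain ⟨n, rfl⟩ : ∃ n : ℕ, i = 1 - ((n + 1 : ℕ) : ℤ) := ⟨(-i).toNat, by omega⟩
    have e1 : 1 - ((n + 1 : ℕ) : ℤ) + -1 = 1 - ((n + 2 : ℕ) : ℤ) := by push_cast; ring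
    have e2 : 1 - ((n + 1 : ℕ) : ℤ) - -1 = 1 - ((n : ℕ) : ℤ) := by push_cast; ring
    rw [e1, e2, extend_one_sub_nat, extend_one_sub_nat, extend_one_sub_nat, ray]
    push_cast
    rfl

variable (d : AxisData K) (x : Pt K)

theorem construct_row_zero (i : ℤ) : d.construct x i 0 = d.row0 i := by
  simp [AxisData.construct, AxisData.row]

theorem construct_row_step {j t : ℤ} (h : 0 ≤ j ∧ t = 1 ∨ j ≤ 0 ∧ t = -1) (i : ℤ) :
    d.construct x i (j + t) =
      extend (fun i => d.construct x i j) (d.col0 (j + t)) (d.col1 x (j + t)) i := by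
  rcases h with ⟨hj, rfl⟩ | ⟨hj, rfl⟩
  · obtain ⟨n, rfl⟩ := Int.eq_ofNat_of_zero_le hj
    have e : (fun i => d.construct x i (n : ℤ)) = d.row x 1 n := by
      funext i
      -- At j = 0 the sign is 0 rather than 1, which is harmless since entry 0 of `row` ignores the
      -- sign.
      rcases n with _ | n
      · simp [AxisData.construct, AxisData.row]
      · simp only [AxisData.construct, Int.natAbs_natCast]
        rw [Int.sign_natCast_of_ne_zero (by simp)]
    rw [e]
    unfold AxisData.construct
    rw [show ((n : ℤ) + 1) = ((n + 1 : ℕ) : ℤ) by push_cast; ring, Int.natAbs_natCast,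
      Int.sign_natCast_of_ne_zero (by simp), AxisData.row]
    push_cast
    simp only [one_mul]
  · obtain ⟨n, rfl⟩ : ∃ n : ℕ, j = -(n : ℤ) := ⟨(-j).toNat, by omega⟩
    have e : (fun i => d.construct x i (-(n : ℤ))) = d.row x (-1) n := by
      funext i
      rcases n with _ | n
      · simp [AxisData.construct, AxisData.row]
      · simp only [AxisData.construct, Int.natAbs_neg, Int.natAbs_natCast, Int.sign_neg]
        rw [Int.sign_natCast_of_ne_zero (by simp)]
    rw [e]
    unfold AxisData.construct
    rw [show (-(n : ℤ) + -1) = -((n + 1 : ℕ) : ℤ) by push_cast; ring, Int.natAbs_neg,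
      Int.natAbs_natCast, Int.sign_neg, Int.sign_natCast_of_ne_zero (by simp), AxisData.row]
    push_cast
    simp only [neg_mul, one_mul]

theorem construct_col_zero (h0 : d.row0 0 = d.col0 0) (j : ℤ) :
    d.construct x 0 j = d.col0 j := by
  rcases lt_trichotomy j 0 with hj | rfl | hj
  · obtain ⟨k, rfl⟩ : ∃ k, j = k + -1 := ⟨j + 1, by ring⟩
    rw [construct_row_step d x (Or.inr ⟨by omega, rfl⟩), extend_zero]
  · rw [construct_row_zero, h0]
  · obtain ⟨k, rfl⟩ : ∃ k, j = k + 1 := ⟨j - 1, by ring⟩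
    rw [construct_row_step d x (Or.inl ⟨by omega, rfl⟩), extend_zero]

theorem construct_col_one (j : ℤ) : d.construct x 1 j = d.col1 x j := by
  rcases lt_trichotomy j 0 with hj | rfl | hj
  · obtain ⟨k, rfl⟩ : ∃ k, j = k + -1 := ⟨j + 1, by ring⟩
    rw [construct_row_step d x (Or.inr ⟨by omega, rfl⟩), extend_one]
  · rw [construct_row_zero, AxisData.col1, extend_zero]
  · obtain ⟨k, rfl⟩ : ∃ k, j = k + 1 := ⟨j - 1, by ring⟩
    rw [construct_row_step d x (Or.inl ⟨by omega, rfl⟩), extend_one]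

theorem construct_one_one : d.construct x 1 1 =
    (x.submodule, regulusLine (d.Ax 0) (d.Ax 1) (d.Ay 1) x.submodule) := by
  rw [construct_col_one, AxisData.col1, extend_one]

/-- The horizontal step of the construction. -/
theorem construct_horizontal {i j s t : ℤ} (hs : 1 ≤ i ∧ s = 1 ∨ i ≤ 0 ∧ s = -1)
    (ht : 0 ≤ j ∧ t = 1 ∨ j ≤ 0 ∧ t = -1) :
    nextFlag (d.construct x i j) (d.construct x (i + s) j) (d.construct x i (j + t))
      (d.construct x (i - s) (j + t)).1 = d.construct x (i + s) (j + t) := by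
  simp only [construct_row_step d x ht]
  rw [extend_step _ _ _ hs]

/-- The vertical step of the construction. -/
theorem construct_vertical (h0 : d.row0 0 = d.col0 0) {j t : ℤ}
    (ht : 1 ≤ j ∧ t = 1 ∨ j ≤ 0 ∧ t = -1) :
    nextFlag (d.construct x 0 j) (d.construct x 0 (j + t)) (d.construct x 1 j)
      (d.construct x 1 (j - t)).1 = d.construct x 1 (j + t) := by
  simp only [construct_col_zero d x h0, construct_col_one, AxisData.col1]
  rw [extend_step _ _ _ ht]

end Grid

/-! ### Normalising representatives on one quadrilateral of a cycle. -/

section CycleQuads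

variable {K : Type*} [Field K]

/-- Skewness of adjacent diagonal lines makes every coefficient in the four expressions for H
nonzero, so all vectors can be rescaled to have H as a difference along each edge; the normalisation
is l = 1. -/
theorem exists_quadFrame_of_vectors {f₀ f₁ f₂ f₃ g₀ g₁ g₂ g₃ H V : Fin 4 → K}
    (h01 : Indep4 f₀ g₀ f₁ g₁) (h02 : Indep4 f₀ g₀ f₂ g₂) (h13 : Indep4 f₁ g₁ f₃ g₃)
    (h23 : Indep4 f₂ g₂ f₃ g₃) (hH : H ≠ 0)
    (hf1 : H ∈ span K {f₀, f₁}) (hf2 : H ∈ span K {f₂, f₃})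
    (hg1 : H ∈ span K {g₀, g₂}) (hg2 : H ∈ span K {g₁, g₃})
    (hk : span K {V} = span K {f₀, f₂} ⊓ span K {f₁, f₃})
    (hk1 : V ∈ span K {g₀, g₁}) (hk2 : V ∈ span K {g₂, g₃})
    (hg : span K {g₀, g₁} ≠ span K {g₂, g₃}) :
    ∃ F G H N l m, QuadFrame (span K {f₀}, span K {f₀, g₀}) (span K {f₁}, span K {f₁, g₁})
      (span K {f₂}, span K {f₂, g₂}) (span K {f₃}, span K {f₃, g₃}) F G H N l m := by
  obtain ⟨α, β, e1⟩ := mem_span_pair.1 hf1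
  obtain ⟨γ, δ, e2⟩ := mem_span_pair.1 hf2
  obtain ⟨α', β', e3⟩ := mem_span_pair.1 hg1
  obtain ⟨γ', δ', e4⟩ := mem_span_pair.1 hg2
  have hα : α ≠ 0 := by
    rintro rfl
    obtain ⟨k1, -⟩ := h13 β (-γ') 0 (-δ') (by linear_combination (norm := module) e1 - e4)
    exact hH (by rw [← e1, k1]; module)
  have hβ : β ≠ 0 := by
    rintro rfl
    obtain ⟨k1, -⟩ := h02 α (-α') 0 (-β') (by linear_combination (norm := module) e1 - e3)
    exact hH (by rw [← e1, k1]; module)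
  have hγ : γ ≠ 0 := by
    rintro rfl
    obtain ⟨-, -, k1, -⟩ := h13 0 (-γ') δ (-δ') (by linear_combination (norm := module) e2 - e4)
    exact hH (by rw [← e2, k1]; module)
  have hδ : δ ≠ 0 := by
    rintro rfl
    obtain ⟨-, -, k1, -⟩ := h02 0 (-α') γ (-β') (by linear_combination (norm := module) e2 - e3)
    exact hH (by rw [← e2, k1]; module)
  have hα' : α' ≠ 0 := by
    rintro rfl
    obtain ⟨-, k1, -, -⟩ := h23 (-γ) β' (-δ) 0 (by linear_combination (norm := module) e3 - e2)
    exact hH (by rw [← e3, k1]; module)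
  have hβ' : β' ≠ 0 := by
    rintro rfl
    obtain ⟨-, k1, -, -⟩ := h01 (-α) α' (-β) 0 (by linear_combination (norm := module) e3 - e1)
    exact hH (by rw [← e3, k1]; module)
  have hγ' : γ' ≠ 0 := by
    rintro rfl
    obtain ⟨-, -, -, k1⟩ := h23 (-γ) 0 (-δ) δ' (by linear_combination (norm := module) e4 - e2)
    exact hH (by rw [← e4, k1]; module)
  have hδ' : δ' ≠ 0 := by
    rintro rfl
    obtain ⟨-, -, -, k1⟩ := h01 (-α) 0 (-β) γ' (by linear_combination (norm := module) e4 - e1)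
    exact hH (by rw [← e4, k1]; module)
  -- By equality of the two expressions of H in `f`, this vector is also δf₃ - βf₁. It therefore
  -- lies on both vertical edges and represents the second Laplace transform.
  set N := α • f₀ - γ • f₂ with hN
  have hN1 : N ∈ span K {f₀, f₂} := mem_span_pair.2 ⟨α, -γ, by rw [hN]; module⟩
  have hN2 : N ∈ span K {f₁, f₃} := mem_span_pair.2 ⟨-β, δ, by
    rw [hN]; linear_combination (norm := module) e2 - e1⟩
  have hN0 : N ≠ 0 := fun h0 =>
    hα (h02 α 0 (-γ) 0 (by rw [hN] at h0; linear_combination (norm := module) h0)).1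
  obtain ⟨r, hr⟩ := mem_span_singleton.1 (hk ▸ mem_inf.2 ⟨hN1, hN2⟩ : N ∈ span K {V})
  have hNg1 : N ∈ span K {g₀, g₁} := hr ▸ Submodule.smul_mem _ _ hk1
  have hNg2 : N ∈ span K {g₂, g₃} := hr ▸ Submodule.smul_mem _ _ hk2
  have i01 : Indep2 g₀ g₁ := fun s t e => by
    obtain ⟨-, k1, -, k2⟩ := h01 0 s 0 t (by linear_combination (norm := module) e)
    exact ⟨k1, k2⟩
  have i23 : Indep2 g₂ g₃ := fun s t e => by
    obtain ⟨-, k1, -, k2⟩ := h23 0 s 0 t (by linear_combination (norm := module) e)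
    exact ⟨k1, k2⟩
  -- This vector equals δ'g₃ - β'g₂, so it lies on both horizontal edges of `g`. These are distinct
  -- lines through N, hence meet only in the point N.
  have hM : α' • g₀ - γ' • g₁ ∈ span K {N} := by
    by_contra hn
    have hI := indep2_of_notMem hN0 hn
    apply hg
    rw [i01.isLine.eq_span hI hNg1 (mem_span_pair.2 ⟨α', -γ', by module⟩),
      i23.isLine.eq_span hI hNg2 (mem_span_pair.2 ⟨-β', δ', by
        linear_combination (norm := module) e4 - e3⟩)]
  obtain ⟨m, hm⟩ := mem_span_singleton.1 hM
  have hm0 : m ≠ 0 := by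
    rintro rfl
    exact hα' (i01 α' (-γ') (by linear_combination (norm := module) -hm)).1
  have hInd : Indep4 (α • f₀) (α' • g₀) H N := by
    intro x y z w e
    -- Multiplication by m replaces mN by α'g₀ - γ'g₁, so the relation is read in the basis f₀, g₀,
    -- f₁, g₁.
    obtain ⟨k1, k2, k3, k4⟩ := h01 (m * (x * α + z * α)) (m * y * α' + w * α')
      (m * z * β) (-(w * γ'))
      (by linear_combination (norm := module) m • e + (m * z) • e1 - w • hm)
    have hz : z = 0 := by simpa [hm0, hβ] using k3
    have hw : w = 0 := by simpa [hγ'] using k4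
    subst hz hw
    exact ⟨by simpa [hm0, hα] using k1, by simpa [hm0, hα'] using k2, rfl, rfl⟩
  have q1 : α • f₀ - H = (-β) • f₁ := by rw [← e1]; module
  have q2 : α • f₀ - N = γ • f₂ := by rw [hN]; module
  have q3 : α • f₀ - H - N = (-δ) • f₃ := by rw [hN, ← e2]; module
  have q4 : α' • g₀ - m • N = γ' • g₁ := by rw [hm]; module
  have q5 : α' • g₀ - (1 : K) • H = (-β') • g₂ := by rw [← e3]; module
  have q6 : α' • g₀ - (1 : K) • H - m • N = (-δ') • g₃ := by rw [hm, ← e4]; module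
  have line : ∀ {u v : Fin 4 → K} {s t : K}, s ≠ 0 → t ≠ 0 →
      span K {u, v} = span K {s • u, t • v} := by
    intro u v s t hs ht
    rw [← span_sup_span, ← span_sup_span, span_singleton_smul_eq (IsUnit.mk0 _ hs),
      span_singleton_smul_eq (IsUnit.mk0 _ ht)]
  refine ⟨α • f₀, α' • g₀, H, N, 1, m, hInd, one_ne_zero, hm0, ?_, ?_, ?_, ?_, ?_, ?_, ?_, ?_⟩
  · rw [span_singleton_smul_eq (IsUnit.mk0 _ hα)]
  · rw [q1, span_singleton_smul_eq (IsUnit.mk0 _ (neg_ne_zero.2 hβ))]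
  · rw [q2, span_singleton_smul_eq (IsUnit.mk0 _ hγ)]
  · rw [q3, span_singleton_smul_eq (IsUnit.mk0 _ (neg_ne_zero.2 hδ))]
  · exact line hα hα'
  · rw [q1, q4]; exact line (neg_ne_zero.2 hβ) hγ'
  · rw [q2, q5]; exact line hγ (neg_ne_zero.2 hβ')
  · rw [q3, q6]; exact line (neg_ne_zero.2 hδ) (neg_ne_zero.2 hδ')

end CycleQuads

/-! ### Incidences in a Laplace cycle. -/

section Cycles

variable {K : Type*} [Field K]

theorem finrank_join2_le (x y : Pt K) : finrank K (join2 x y) ≤ 2 := by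
  obtain ⟨v, -, ev⟩ := Pt.exists_vec x
  obtain ⟨w, -, ew⟩ := Pt.exists_vec y
  rw [join2, ev, ew, span_sup_span]
  exact finrank_span_pair_le

theorem isLine_join2 {x y : Pt K} (h : x ≠ y) : IsLine (join2 x y) := by
  obtain ⟨v, hv, ev⟩ := Pt.exists_vec x
  obtain ⟨w, hw, ew⟩ := Pt.exists_vec y
  rw [join2, ev, ew, span_sup_span]
  refine (indep2_of_notMem hv fun hm => h (Pt.eq_of_le ?_).symm).isLine
  rwa [ev, ew, span_singleton_le]

theorem left_le_join2 (x y : Pt K) : x.submodule ≤ join2 x y := le_sup_left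

theorem right_le_join2 (x y : Pt K) : y.submodule ≤ join2 x y := le_sup_right

theorem join2_le {x y : Pt K} {L : Sub K} (hx : x.submodule ≤ L) (hy : y.submodule ≤ L) :
    join2 x y ≤ L := sup_le hx hy

theorem eq_join2 {L : Sub K} {x y : Pt K} (hL : finrank K L ≤ 2) (h : x ≠ y)
    (hx : x.submodule ≤ L) (hy : y.submodule ≤ L) : join2 x y = L := by
  have h2 : finrank K (join2 x y) = 2 := isLine_join2 h
  exact eq_of_le_of_finrank_le (join2_le hx hy) (by omega)

theorem IsRegular.ne₁ {f : Net K} (h : IsRegular f) (i j : ℤ) : f i j ≠ f (i + 1) j := by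
  intro e
  have h1 := h.osc1_plane i j
  rw [osc1, join3, ← e, sup_assoc, sup_idem] at h1
  have h2 := finrank_join2_le (f (i - 1) j) (f i j)
  rw [join2] at h2
  omega

theorem IsRegular.ne₂ {f : Net K} (h : IsRegular f) (i j : ℤ) : f i j ≠ f i (j + 1) := by
  intro e
  have h1 := h.osc2_plane i j
  rw [osc2, join3, ← e, sup_assoc, sup_idem] at h1
  have h2 := finrank_join2_le (f i (j - 1)) (f i j)
  rw [join2] at h2
  omega

theorem IsRegular.join_ne {f : Net K} (h : IsRegular f) (i j : ℤ) :
    join2 (f i j) (f (i + 1) j) ≠ join2 (f i (j + 1)) (f (i + 1) (j + 1)) := by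
  intro e
  have h1 := h.not_collinear i j
  rw [face, ← e, sup_idem] at h1
  have h2 := finrank_join2_le (f i j) (f (i + 1) j)
  omega

variable {f h g k : Net K}

namespace IsLaplaceCycle

/-- With the index shift of `g`, the horizontal edge of `h` from i - 1 to i at height j carries the
transforms of the faces below and above it, namely the points of `g` at (i, j) and (i, j + 1). -/
theorem join_g_vertical (hc : IsLaplaceCycle f h g k) (i j : ℤ) :
    join2 (g i j) (g i (j + 1)) = join2 (h (i - 1) j) (h i j) := by
  refine eq_join2 (finrank_join2_le _ _) (hc.g_reg.ne₂ i j) ?_ ?_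
  · have := hc.g_eq_first (i - 1) (j - 1)
    simp only [sub_add_cancel] at this
    exact this.le.trans inf_le_right
  · have := hc.g_eq_first (i - 1) j
    simp only [sub_add_cancel] at this
    exact this.le.trans inf_le_left

theorem join_g_horizontal (hc : IsLaplaceCycle f h g k) (i j : ℤ) :
    join2 (g i j) (g (i + 1) j) = join2 (k i (j - 1)) (k i j) := by
  refine eq_join2 (finrank_join2_le _ _) (hc.g_reg.ne₁ i j) ?_ ?_
  · have := hc.g_eq_second (i - 1) (j - 1)
    simp only [sub_add_cancel] at this
    exact this.le.trans inf_le_right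
  · have := hc.g_eq_second i (j - 1)
    simp only [sub_add_cancel] at this
    exact this.le.trans inf_le_left

/-- The point of `g` lies on a line joining two points of `h`, and these lie on the two horizontal
edges of `f` that meet at (i, j). -/
theorem diagonal_le_osc1 (hc : IsLaplaceCycle f h g k) (i j : ℤ) :
    diagonal f g i j ≤ osc1 f i j := by
  refine join2_le (le_sup_right.trans le_sup_left) ?_
  refine ((left_le_join2 _ _).trans (hc.join_g_vertical i j).le).trans (join2_le ?_ ?_)
  · have := hc.h_eq (i - 1) j
    simp only [sub_add_cancel] at this
    exact (this.le.trans inf_le_left).trans le_sup_left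
  · refine ((hc.h_eq i j).le.trans inf_le_left).trans (join2_le ?_ ?_)
    · exact le_sup_right.trans le_sup_left
    · exact le_sup_right

theorem diagonal_le_osc2 (hc : IsLaplaceCycle f h g k) (i j : ℤ) :
    diagonal f g i j ≤ osc2 f i j := by
  refine join2_le (le_sup_right.trans le_sup_left) ?_
  refine ((left_le_join2 _ _).trans (hc.join_g_horizontal i j).le).trans (join2_le ?_ ?_)
  · have := hc.k_eq i (j - 1)
    simp only [sub_add_cancel] at this
    exact (this.le.trans inf_le_left).trans le_sup_left
  · refine ((hc.k_eq i j).le.trans inf_le_left).trans (join2_le ?_ ?_)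
    · exact le_sup_right.trans le_sup_left
    · exact le_sup_right

theorem exists_quadFrame (hc : IsLaplaceCycle f h g k) (hp : InGeneralPosition f h g k) (i j : ℤ) :
    ∃ F G H N l m, QuadFrame (cycleFlag f g i j) (cycleFlag f g (i + 1) j)
      (cycleFlag f g i (j + 1)) (cycleFlag f g (i + 1) (j + 1)) F G H N l m := by
  have s01 := (hp.skew i j).1
  have s02 := (hp.skew i j).2
  have s13 := (hp.skew (i + 1) j).2
  have s23 := (hp.skew i (j + 1)).1
  have d0 := isLine_join2 (hp.f_ne_g i j)
  have d1 := isLine_join2 (hp.f_ne_g (i + 1) j)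
  have d2 := isLine_join2 (hp.f_ne_g i (j + 1))
  have d3 := isLine_join2 (hp.f_ne_g (i + 1) (j + 1))
  have hf1 := (hc.h_eq i j).le.trans inf_le_left
  have hf2 := (hc.h_eq i j).le.trans inf_le_right
  have hg1 := (right_le_join2 _ _).trans (hc.join_g_vertical i j).ge
  have hg2 := (left_le_join2 _ _).trans (hc.join_g_vertical (i + 1) j).ge
  have hk1 := (right_le_join2 _ _).trans (hc.join_g_horizontal i j).ge
  have hk2 := (left_le_join2 _ _).trans (hc.join_g_horizontal i (j + 1)).ge
  simp only [add_sub_cancel_right] at hg2 hk2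
  have hk := hc.k_eq i j
  have hg := hc.g_reg.join_ne i j
  obtain ⟨f₀, f₀0, ef₀⟩ := Pt.exists_vec (f i j)
  obtain ⟨f₁, f₁0, ef₁⟩ := Pt.exists_vec (f (i + 1) j)
  obtain ⟨f₂, f₂0, ef₂⟩ := Pt.exists_vec (f i (j + 1))
  obtain ⟨f₃, f₃0, ef₃⟩ := Pt.exists_vec (f (i + 1) (j + 1))
  obtain ⟨g₀, g₀0, eg₀⟩ := Pt.exists_vec (g i j)
  obtain ⟨g₁, g₁0, eg₁⟩ := Pt.exists_vec (g (i + 1) j)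
  obtain ⟨g₂, g₂0, eg₂⟩ := Pt.exists_vec (g i (j + 1))
  obtain ⟨g₃, g₃0, eg₃⟩ := Pt.exists_vec (g (i + 1) (j + 1))
  obtain ⟨H, H0, eH⟩ := Pt.exists_vec (h i j)
  obtain ⟨V, V0, eV⟩ := Pt.exists_vec (k i j)
  simp only [cycleFlag, diagonal, join2, ef₀, ef₁, ef₂, ef₃, eg₀, eg₁, eg₂, eg₃, eH, eV,
    span_sup_span, span_singleton_le] at *
  have ind : ∀ {u v : Fin 4 → K}, u ≠ 0 → IsLine (span K {u, v}) → Indep2 u v := by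
    intro u v hu hL
    refine indep2_of_notMem hu fun hm => ?_
    have h1 : finrank K (span K {u, v}) ≤ finrank K (span K {u}) :=
      finrank_mono (span_pair_le (mem_span_singleton_self _) hm)
    rw [finrank_span_singleton hu, hL] at h1
    omega
  exact exists_quadFrame_of_vectors (s01.indep4 (ind f₀0 d0) (ind f₁0 d1))
    (s02.indep4 (ind f₀0 d0) (ind f₂0 d2)) (s13.indep4 (ind f₁0 d1) (ind f₃0 d3))
    (s23.indep4 (ind f₂0 d2) (ind f₃0 d3)) H0 hf1 hf2 hg1 hg2 hk hk1 hk2 hg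

end IsLaplaceCycle

/-- A family of flags has normal forms on all quadrilaterals. -/
def HasFrames (a : ℤ → ℤ → Flag K) : Prop :=
  ∀ i j, ∃ F G H N l m, QuadFrame (a i j) (a (i + 1) j) (a i (j + 1)) (a (i + 1) (j + 1))
    F G H N l m

theorem HasFrames.signs {a : ℤ → ℤ → Flag K} (h : HasFrames a) (i j : ℤ) {s t : ℤ}
    (hs : s = 1 ∨ s = -1) (ht : t = 1 ∨ t = -1) :
    ∃ F G H N l m, QuadFrame (a i j) (a (i + s) j) (a i (j + t)) (a (i + s) (j + t))
      F G H N l m := by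
  rcases hs with rfl | rfl <;> rcases ht with rfl | rfl
  · exact h i j
  · obtain ⟨F, G, H, N, l, m, hF⟩ := h i (j + -1)
    rw [neg_add_cancel_right] at hF
    exact ⟨_, _, _, _, _, _, hF.flip'⟩
  · obtain ⟨F, G, H, N, l, m, hF⟩ := h (i + -1) j
    rw [neg_add_cancel_right] at hF
    exact ⟨_, _, _, _, _, _, hF.flip⟩
  · obtain ⟨F, G, H, N, l, m, hF⟩ := h (i + -1) (j + -1)
    rw [neg_add_cancel_right, neg_add_cancel_right] at hF
    exact ⟨_, _, _, _, _, _, hF.flip.flip'⟩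

end Cycles

/-! ### Suitable data, reproduction by projections, and uniqueness. -/

section CycleProperties

variable {K : Type*} [Field K]

/-- Applied with P an osculating plane, this identifies P with the plane of a projection step. -/
theorem le_sup_line {A P : Sub K} {p r : Pt K} (hA : IsLine A) (hp : ¬ p.submodule ≤ A)
    (hP : finrank K P ≤ 3) (hAP : A ≤ P) (hpP : p.submodule ≤ P) (hr : r.submodule ≤ P) :
    finrank K (p.submodule ⊔ A : Sub K) ≤ 3 ∧ r.submodule ≤ p.submodule ⊔ A := by
  have h3 := finrank_point_sup_line (Pt.finrank p).le hA
  refine ⟨h3, ?_⟩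
  rwa [← plane_eq hA hp hP h3 hAP le_sup_right hpP le_sup_left]

theorem finrank_join3_le (x y z : Pt K) : finrank K (join3 x y z) ≤ 3 := by
  obtain ⟨u, -, eu⟩ := Pt.exists_vec x
  obtain ⟨v, -, ev⟩ := Pt.exists_vec y
  obtain ⟨w, -, ew⟩ := Pt.exists_vec z
  rw [join3, eu, ev, ew, span_sup_span_sup_span]
  exact finrank_span_triple_le

theorem le_osc1 (f : Net K) (i j : ℤ) {s : ℤ} (hs : s = 1 ∨ s = -1) :
    (f (i + s) j).submodule ≤ osc1 f i j := by
  rcases hs with rfl | rfl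
  · exact le_sup_right
  · exact le_sup_left.trans le_sup_left

theorem le_osc2 (f : Net K) (i j : ℤ) {t : ℤ} (ht : t = 1 ∨ t = -1) :
    (f i (j + t)).submodule ≤ osc2 f i j := by
  rcases ht with rfl | rfl
  · exact le_sup_right
  · exact le_sup_left.trans le_sup_left

theorem neg_sign {s : ℤ} (hs : s = 1 ∨ s = -1) : -s = 1 ∨ -s = -1 := by omega

theorem AdjacentSkew.horizontal {A : Congruence K} (h : AdjacentSkew A) (i j : ℤ) {s : ℤ}
    (hs : s = 1 ∨ s = -1) : Skew (A i j) (A (i + s) j) := by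
  rcases hs with rfl | rfl
  · exact (h i j).1
  · have := (h (i + -1) j).1
    rw [neg_add_cancel_right] at this
    exact this.symm

theorem AdjacentSkew.vertical {A : Congruence K} (h : AdjacentSkew A) (i j : ℤ) {t : ℤ}
    (ht : t = 1 ∨ t = -1) : Skew (A i j) (A i (j + t)) := by
  rcases ht with rfl | rfl
  · exact (h i j).2
  · have := (h i (j + -1)).2
    rw [neg_add_cancel_right] at this
    exact this.symm

theorem OppositeSkew.signs {A : Congruence K} (h : OppositeSkew A) (i j : ℤ) {s t : ℤ}
    (hs : s = 1 ∨ s = -1) (ht : t = 1 ∨ t = -1) :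
    Skew (A i j) (A (i + s) (j + t)) ∧ Skew (A (i + s) j) (A i (j + t)) := by
  rcases hs with rfl | rfl <;> rcases ht with rfl | rfl
  · exact h i j
  · have := h i (j + -1)
    rw [neg_add_cancel_right] at this
    exact ⟨this.2.symm, this.1.symm⟩
  · have := h (i + -1) j
    rw [neg_add_cancel_right] at this
    exact ⟨this.2, this.1⟩
  · have := h (i + -1) (j + -1)
    rw [neg_add_cancel_right, neg_add_cancel_right] at this
    exact ⟨this.1.symm, this.2.symm⟩

theorem next_mem_horizontal {f : Net K} {A : Congruence K} (hA : ∀ i j, IsLine (A i j))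
    (hsk : AdjacentSkew A) (hm : ∀ i j, (f i j).submodule ≤ A i j)
    (ho : ∀ i j, A i j ≤ osc1 f i j) (i j : ℤ) {s : ℤ} (hs : s = 1 ∨ s = -1) :
    finrank K ((f (i - s) j).submodule ⊔ A i j : Sub K) ≤ 3 ∧
      (f (i + s) j).submodule ≤ (f (i - s) j).submodule ⊔ A i j := by
  rw [sub_eq_add_neg]
  exact le_sup_line (hA i j)
    (Pt.not_le_of_skew (hsk.horizontal i j (neg_sign hs)).symm (hm _ _))
    (finrank_join3_le _ _ _) (ho i j) (le_osc1 f i j (neg_sign hs)) (le_osc1 f i j hs)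

theorem next_mem_vertical {f : Net K} {A : Congruence K} (hA : ∀ i j, IsLine (A i j))
    (hsk : AdjacentSkew A) (hm : ∀ i j, (f i j).submodule ≤ A i j)
    (ho : ∀ i j, A i j ≤ osc2 f i j) (i j : ℤ) {t : ℤ} (ht : t = 1 ∨ t = -1) :
    finrank K ((f i (j - t)).submodule ⊔ A i j : Sub K) ≤ 3 ∧
      (f i (j + t)).submodule ≤ (f i (j - t)).submodule ⊔ A i j := by
  rw [sub_eq_add_neg]
  exact le_sup_line (hA i j)
    (Pt.not_le_of_skew (hsk.vertical i j (neg_sign ht)).symm (hm _ _))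
    (finrank_join3_le _ _ _) (ho i j) (le_osc2 f i j (neg_sign ht)) (le_osc2 f i j ht)

variable {f h g k f' h' g' k' : Net K}

theorem le_diagonal (f g : Net K) (i j : ℤ) : (f i j).submodule ≤ diagonal f g i j :=
  left_le_join2 _ _

theorem IsLaplaceCycle.hasFrames (hc : IsLaplaceCycle f h g k) (hp : InGeneralPosition f h g k) :
    HasFrames (cycleFlag f g) := fun i j => hc.exists_quadFrame hp i j

theorem IsLaplaceCycle.horizontal (hc : IsLaplaceCycle f h g k) (hp : InGeneralPosition f h g k)
    (i j : ℤ) {s : ℤ} (hs : s = 1 ∨ s = -1) :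
    finrank K ((f (i - s) j).submodule ⊔ diagonal f g i j : Sub K) ≤ 3 ∧
      (f (i + s) j).submodule ≤ (f (i - s) j).submodule ⊔ diagonal f g i j :=
  next_mem_horizontal (fun i j => isLine_join2 (hp.f_ne_g i j)) hp.skew (le_diagonal f g)
    hc.diagonal_le_osc1 i j hs

theorem IsLaplaceCycle.vertical (hc : IsLaplaceCycle f h g k) (hp : InGeneralPosition f h g k)
    (i j : ℤ) {t : ℤ} (ht : t = 1 ∨ t = -1) :
    finrank K ((f i (j - t)).submodule ⊔ diagonal f g i j : Sub K) ≤ 3 ∧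
      (f i (j + t)).submodule ≤ (f i (j - t)).submodule ⊔ diagonal f g i j :=
  next_mem_vertical (fun i j => isLine_join2 (hp.f_ne_g i j)) hp.skew (le_diagonal f g)
    hc.diagonal_le_osc2 i j ht

/-- Both projection steps reproduce the values of a cycle. -/
theorem IsLaplaceCycle.nextFlag_eq (hc : IsLaplaceCycle f h g k)
    (hp : InGeneralPosition f h g k) (ho : OppositeSkew (diagonal f g)) (i j : ℤ) {s t : ℤ}
    (hs : s = 1 ∨ s = -1) (ht : t = 1 ∨ t = -1) :
    nextFlag (cycleFlag f g i j) (cycleFlag f g (i + s) j) (cycleFlag f g i (j + t))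
        (cycleFlag f g (i - s) (j + t)).1 = cycleFlag f g (i + s) (j + t) ∧
      nextFlag (cycleFlag f g i j) (cycleFlag f g i (j + t)) (cycleFlag f g (i + s) j)
        (cycleFlag f g (i + s) (j - t)).1 = cycleFlag f g (i + s) (j + t) := by
  obtain ⟨F, G, H, N, l, m, hF⟩ := (hc.hasFrames hp).signs i j hs ht
  have hlm : l ≠ m := hF.ne_of_skew (ho.signs i j hs ht).2
  have h1 := hc.horizontal hp i (j + t) hs
  have h2 := hc.vertical hp (i + s) j ht
  exact ⟨hF.nextFlag_eq hlm h1.1 h1.2, hF.swap.nextFlag_eq hlm.symm h2.1 h2.2⟩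

theorem IsLaplaceCycle.isSuitable (hc : IsLaplaceCycle f h g k)
    (hp : InGeneralPosition f h g k) : (axisData f g).IsSuitable where
  f_origin := rfl
  A_origin := rfl
  line_x i := isLine_join2 (hp.f_ne_g i 0)
  line_y i := isLine_join2 (hp.f_ne_g 0 i)
  skew_x i := (hp.skew i 0).1
  skew_y i := (hp.skew 0 i).2
  osc_x i := hc.diagonal_le_osc1 i 0
  osc_y i := hc.diagonal_le_osc2 0 i
  mem_x i := le_diagonal f g i 0
  mem_y i := le_diagonal f g 0 i

theorem IsLaplaceCycle.mem_conic (hc : IsLaplaceCycle f h g k)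
    (hp : InGeneralPosition f h g k) (hs : Skew (diagonal f g 1 0) (diagonal f g 0 1)) :
    f 1 1 ∈ (axisData f g).conic := by
  obtain ⟨F, G, H, N, l, m, hF⟩ := (hc.hasFrames hp) 0 0
  exact ⟨⟨_, hF.line_mem_regulus (hF.ne_of_skew hs), le_diagonal f g 1 1⟩, hF.d_mem_plane⟩

theorem IsLaplace1.unique (h₁ : IsLaplace1 f h) (h₂ : IsLaplace1 f h') : h = h' := by
  funext i j
  exact Projectivization.submodule_injective ((h₁ i j).trans (h₂ i j).symm)

theorem IsLaplace2.unique (h₁ : IsLaplace2 f k) (h₂ : IsLaplace2 f k') : k = k' := by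
  funext i j
  exact Projectivization.submodule_injective ((h₁ i j).trans (h₂ i j).symm)

/-- A cycle is determined by its values on the axes and at `(1, 1)`. -/
theorem IsLaplaceCycle.unique (hc : IsLaplaceCycle f h g k) (hp : InGeneralPosition f h g k)
    (hc' : IsLaplaceCycle f' h' g' k') (hp' : InGeneralPosition f' h' g' k')
    (hd : axisData f g = axisData f' g') (h11 : f 1 1 = f' 1 1) :
    f = f' ∧ h = h' ∧ g = g' ∧ k = k' := by
  -- Opposite lines may meet here, so the quadric is not available; uniqueness of the fourth corner
  -- comes from its plane or, at (1, 1), from its point.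
  have key : ∀ i j, cycleFlag f g i j = cycleFlag f' g' i j := by
    have hx : ∀ i, cycleFlag f g i 0 = cycleFlag f' g' i 0 := fun i =>
      Prod.ext (congrArg (fun d : AxisData K => (d.fx i).submodule) hd)
        (congrArg (fun d : AxisData K => d.Ax i) hd)
    have hy : ∀ j, cycleFlag f g 0 j = cycleFlag f' g' 0 j := fun j =>
      Prod.ext (congrArg (fun d : AxisData K => (d.fy j).submodule) hd)
        (congrArg (fun d : AxisData K => d.Ay j) hd)
    refine grid_induction hx hy ?_ ?_ ?_
    · obtain ⟨F, G, H, N, l, m, hF⟩ := (hc.hasFrames hp) 0 0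
      obtain ⟨F', G', H', N', l', m', hF'⟩ := (hc'.hasFrames hp') 0 0
      simp only [zero_add] at hF hF'
      rw [← hx 0, ← hx 1, ← hy 1] at hF'
      exact hF.eq_of_point hF' (congrArg Projectivization.submodule h11)
    · intro j t ht h1 h2 h3 h4
      have ht' : t = 1 ∨ t = -1 := by omega
      obtain ⟨F, G, H, N, l, m, hF⟩ := (hc.hasFrames hp).signs 0 j (Or.inl rfl) ht'
      obtain ⟨F', G', H', N', l', m', hF'⟩ := (hc'.hasFrames hp').signs 0 j (Or.inl rfl) ht'
      simp only [zero_add] at hF hF'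
      rw [← h1, ← h2, ← h3] at hF'
      have q1 := hc.vertical hp 1 j ht'
      have q2 := hc'.vertical hp' 1 j ht'
      have e1 : (f 1 (j - t)).submodule = (f' 1 (j - t)).submodule := congrArg Prod.fst h4
      have e2 : diagonal f g 1 j = diagonal f' g' 1 j := congrArg Prod.snd h3
      rw [← e1, ← e2] at q2
      exact hF.swap.eq_of_plane hF'.swap q1.1 le_sup_right q1.2 q2.2
    · intro i j s t hs ht h1 h2 h3 h4
      have hs' : s = 1 ∨ s = -1 := by omega
      have ht' : t = 1 ∨ t = -1 := by omega
      obtain ⟨F, G, H, N, l, m, hF⟩ := (hc.hasFrames hp).signs i j hs' ht'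
      obtain ⟨F', G', H', N', l', m', hF'⟩ := (hc'.hasFrames hp').signs i j hs' ht'
      rw [← h1, ← h2, ← h3] at hF'
      have q1 := hc.horizontal hp i (j + t) hs'
      have q2 := hc'.horizontal hp' i (j + t) hs'
      have e1 : (f (i - s) (j + t)).submodule = (f' (i - s) (j + t)).submodule :=
        congrArg Prod.fst h4
      have e2 : diagonal f g i (j + t) = diagonal f' g' i (j + t) := congrArg Prod.snd h3
      rw [← e1, ← e2] at q2
      exact hF.eq_of_plane hF' q1.1 le_sup_right q1.2 q2.2
  have hf : f = f' := by
    funext i j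
    exact Projectivization.submodule_injective (congrArg Prod.fst (key i j))
  subst hf
  have hh := hc.h_eq.unique hc'.h_eq
  have hk := hc.k_eq.unique hc'.k_eq
  subst hh hk
  refine ⟨rfl, rfl, ?_, rfl⟩
  have := hc.g_eq_first.unique hc'.g_eq_first
  funext i j
  simpa using congrFun (congrFun this (i - 1)) (j - 1)

/-- The construction reproduces a cycle. -/
theorem IsLaplaceCycle.construct_eq (hc : IsLaplaceCycle f h g k)
    (hp : InGeneralPosition f h g k) (ho : OppositeSkew (diagonal f g)) (i j : ℤ) :
    (axisData f g).construct (f 1 1) i j = cycleFlag f g i j := by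
  revert i j
  have h0 : (axisData f g).row0 0 = (axisData f g).col0 0 := rfl
  refine grid_induction (fun i => construct_row_zero _ _ i)
    (fun j => construct_col_zero _ _ h0 j) ?_ ?_ ?_
  · rw [construct_one_one]
    obtain ⟨F, G, H, N, l, m, hF⟩ := (hc.hasFrames hp) 0 0
    have hlm : l ≠ m := hF.ne_of_skew (ho 0 0).2
    exact Prod.ext rfl (hF.regulusLine_eq hlm)
  · intro j t ht h1 h2 h3 h4
    rw [← construct_vertical _ _ h0 ht, h1, h2, h3, h4]
    have := (hc.nextFlag_eq hp ho 0 j (s := 1) (Or.inl rfl) (t := t) (by omega)).2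
    simpa using this
  · intro i j s t hs ht h1 h2 h3 h4
    rw [← construct_horizontal _ _ hs ht, h1, h2, h3, h4]
    exact (hc.nextFlag_eq hp ho i j (by omega) (by omega)).1

theorem IsLaplaceCycle.constructionRegular (hc : IsLaplaceCycle f h g k)
    (hp : InGeneralPosition f h g k) (ho : OppositeSkew (diagonal f g)) :
    (axisData f g).ConstructionRegular (f 1 1) :=
  ⟨f, diagonal f g, hc.construct_eq hp ho, fun i j => isLine_join2 (hp.f_ne_g i j), hp.skew, ho,
    hc.f_reg, hp.osc_f, fun _ hh' => hc.h_eq.unique hh' ▸ hc.h_reg,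
    fun _ hk' => hc.k_eq.unique hk' ▸ hc.k_reg⟩

end CycleProperties

/-! ### From compatible normal forms to a Laplace cycle. -/

section Existence

variable {K : Type*} [Field K]

namespace QuadFrame

variable {a b c d : Flag K} {F G H N : Fin 4 → K} {l m : K}

theorem laplace_point (h : QuadFrame a b c d F G H N l m) :
    span K {H} = (a.1 ⊔ b.1) ⊓ (c.1 ⊔ d.1) := by
  rw [h.a_pt, h.b_pt, h.c_pt, h.d_pt, span_sup_span, span_sup_span]
  apply le_antisymm
  · rw [span_singleton_le]
    exact mem_inf.2 ⟨mem_span_pair.2 ⟨1, -1, by module⟩, mem_span_pair.2 ⟨1, -1, by module⟩⟩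
  · intro v hv
    obtain ⟨h1, h2⟩ := mem_inf.1 hv
    obtain ⟨s, t, rfl⟩ := mem_span_pair.1 h1
    obtain ⟨p, q, e⟩ := mem_span_pair.1 h2
    obtain ⟨k1, -, k3, k4⟩ := h.indep (p + q - s - t) 0 (t - q) (-p - q)
      (by linear_combination (norm := module) e)
    obtain rfl : s = -t := by linear_combination -k1 - k4
    exact mem_span_singleton.2 ⟨-t, by module⟩

theorem finrank_face_le (h : QuadFrame a b c d F G H N l m) :
    finrank K (a.1 ⊔ b.1 ⊔ (c.1 ⊔ d.1) : Sub K) ≤ 3 := by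
  refine (finrank_mono ?_).trans (finrank_span_triple_le (a := F) (b := H) (c := N))
  rw [h.a_pt, h.b_pt, h.c_pt, h.d_pt]
  simp only [sup_le_iff, span_singleton_le, mem_span_triple]
  exact ⟨⟨⟨1, 0, 0, by module⟩, ⟨1, -1, 0, by module⟩⟩, ⟨1, 0, -1, by module⟩,
    ⟨1, -1, -1, by module⟩⟩

end QuadFrame

/-- A normal form of the quadrilateral `(i, j)` of four nets. -/
structure CycleFrame (f h g k : Net K) (i j : ℤ) (F G H N : Fin 4 → K) (l m : K) : Prop where
  frame : QuadFrame (cycleFlag f g i j) (cycleFlag f g (i + 1) j)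
    (cycleFlag f g i (j + 1)) (cycleFlag f g (i + 1) (j + 1)) F G H N l m
  g_a : (g i j).submodule = span K {G}
  g_b : (g (i + 1) j).submodule = span K {G - m • N}
  g_c : (g i (j + 1)).submodule = span K {G - l • H}
  g_d : (g (i + 1) (j + 1)).submodule = span K {G - l • H - m • N}
  h_eq : (h i j).submodule = span K {H}
  k_eq : (k i j).submodule = span K {N}

/-- All quadrilaterals of four nets have a normal form. -/
def HasCycleFrames (f h g k : Net K) : Prop :=
  ∀ i j, ∃ F G H N l m, CycleFrame f h g k i j F G H N l m

/-- The net with interchanged parameter directions. -/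
def transpose (f : Net K) : Net K := fun i j => f j i

variable {f h g k : Net K}

theorem HasCycleFrames.transpose (hF : HasCycleFrames f h g k) :
    HasCycleFrames (transpose f) (transpose k) (transpose g) (transpose h) := by
  intro i j
  obtain ⟨F, G, H, N, l, m, hF⟩ := hF j i
  exact ⟨F, G, N, H, m, l, hF.frame.swap, hF.g_a, hF.g_c, hF.g_b,
    by rw [sub_right_comm]; exact hF.g_d, hF.k_eq, hF.h_eq⟩

theorem face_transpose (f : Net K) (i j : ℤ) : face (transpose f) i j = face f j i :=
  sup_sup_sup_comm _ _ _ _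

theorem IsRegular.transpose (hf : IsRegular f) : IsRegular (transpose f) where
  osc1_plane i j := hf.osc2_plane j i
  osc2_plane i j := hf.osc1_plane j i
  not_collinear i j := by rw [face_transpose]; exact hf.not_collinear j i

theorem point_eq_inf {L M : Sub K} {x : Pt K} (hL : finrank K L ≤ 2) (hM : IsLine M)
    (hne : L ≠ M) (hx : x.submodule ≤ L) (hy : x.submodule ≤ M) : x.submodule = L ⊓ M := by
  refine eq_of_le_of_finrank_le (le_inf hx hy) ?_
  rw [Pt.finrank]
  by_contra! h
  have h1 : finrank K M = 2 := hM
  have e1 : L ⊓ M = L := eq_of_le_of_finrank_le inf_le_left (by omega)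
  have e2 : L ⊓ M = M := eq_of_le_of_finrank_le inf_le_right (by omega)
  exact hne (e1.symm.trans e2)

namespace HasCycleFrames

theorem isLaplace1 (hF : HasCycleFrames f h g k) : IsLaplace1 f h := by
  intro i j
  obtain ⟨F, G, H, N, l, m, hF⟩ := hF i j
  rw [hF.h_eq, hF.frame.laplace_point]
  rfl

theorem h_le_left (hF : HasCycleFrames f h g k) (i j : ℤ) :
    (h i j).submodule ≤ join2 (g i j) (g i (j + 1)) := by
  obtain ⟨F, G, H, N, l, m, hF⟩ := hF i j
  rw [join2, hF.h_eq, hF.g_a, hF.g_c, span_sup_span, span_singleton_le]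
  exact (Submodule.smul_mem_iff _ hF.frame.l_ne).1 (mem_span_pair.2 ⟨1, -1, by module⟩)

theorem h_le_right (hF : HasCycleFrames f h g k) (i j : ℤ) :
    (h i j).submodule ≤ join2 (g (i + 1) j) (g (i + 1) (j + 1)) := by
  obtain ⟨F, G, H, N, l, m, hF⟩ := hF i j
  rw [join2, hF.h_eq, hF.g_b, hF.g_d, span_sup_span, span_singleton_le]
  exact (Submodule.smul_mem_iff _ hF.frame.l_ne).1 (mem_span_pair.2 ⟨1, -1, by module⟩)

theorem join_h (hF : HasCycleFrames f h g k) (hh : IsRegular h) (i j : ℤ) :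
    join2 (h i j) (h (i + 1) j) = join2 (g (i + 1) j) (g (i + 1) (j + 1)) :=
  eq_join2 (finrank_join2_le _ _) (hh.ne₁ i j) (hF.h_le_right i j) (hF.h_le_left (i + 1) j)

/-- Each horizontal edge of `h` is a vertical edge of `g`, so a face of `h` is spanned by two
consecutive vertical edges of `g`. Planarity and noncollinearity of faces of `h` become statements
on the osculating planes of `g`. -/
theorem face_h (hF : HasCycleFrames f h g k) (hh : IsRegular h) (i j : ℤ) :
    face h i j = osc2 g (i + 1) (j + 1) := by
  rw [face, hF.join_h hh, hF.join_h hh, osc2, join3, add_sub_cancel_right, join2, join2,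
    sup_assoc, sup_assoc, ← sup_assoc (g (i + 1) (j + 1)).submodule, sup_idem]

theorem isConjugate_h (hF : HasCycleFrames f h g k) (hh : IsRegular h) : IsConjugate h := by
  intro i j
  rw [hF.face_h hh]
  exact finrank_join3_le _ _ _

theorem finrank_osc2_g (hF : HasCycleFrames f h g k) (hh : IsRegular h) (i j : ℤ) :
    finrank K (osc2 g i j) = 3 := by
  have h1 := hh.not_collinear (i - 1) (j - 1)
  rw [hF.face_h hh, sub_add_cancel, sub_add_cancel] at h1
  have h2 : finrank K (osc2 g i j) ≤ 3 := finrank_join3_le _ _ _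
  omega

theorem isLaplace1_h (hF : HasCycleFrames f h g k) (hh : IsRegular h) :
    IsLaplace1 h (fun i j => g (i + 1) (j + 1)) := by
  intro i j
  refine point_eq_inf (finrank_join2_le _ _) (isLine_join2 (hh.ne₁ _ _)) (hh.join_ne i j) ?_ ?_
  · rw [hF.join_h hh]
    exact right_le_join2 _ _
  · rw [hF.join_h hh]
    exact left_le_join2 _ _

/-- The second osculating plane of `g` is a face of `h`, whose four vertices lie on the two
horizontal edges of `f` at (i, j). Distinct osculating planes of `f` therefore give distinct ones of
`g`. -/
theorem osc2_g (hF : HasCycleFrames f h g k) (hf : IsRegular f) (hh : IsRegular h) (i j : ℤ) :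
    osc2 g i j = osc1 f i j := by
  refine eq_of_le_of_finrank_eq ?_ ((hF.finrank_osc2_g hh i j).trans (hf.osc1_plane i j).symm)
  have e := hF.face_h hh (i - 1) (j - 1)
  rw [sub_add_cancel, sub_add_cancel] at e
  rw [← e]
  have hl := hF.isLaplace1
  have l1 : join2 (f (i - 1) j) (f i j) ≤ osc1 f i j := le_sup_left
  have l2 : join2 (f i j) (f (i + 1) j) ≤ osc1 f i j :=
    join2_le (le_sup_right.trans le_sup_left) le_sup_right
  refine sup_le (join2_le ?_ ?_) (join2_le ?_ ?_)
  · have := (hl (i - 1) (j - 1)).le.trans inf_le_right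
    simp only [sub_add_cancel] at this
    exact this.trans l1
  · have := (hl i (j - 1)).le.trans inf_le_right
    simp only [sub_add_cancel] at this ⊢
    exact this.trans l2
  · have := (hl (i - 1) j).le.trans inf_le_left
    simp only [sub_add_cancel] at this ⊢
    exact this.trans l1
  · simp only [sub_add_cancel]
    exact ((hl i j).le.trans inf_le_left).trans l2

/-- The first osculating plane of `h` contains two vertical edges of `g`, the second one contains a
horizontal edge of `f`. If they coincided, one plane would contain F, G, H and N. -/
theorem osc_h_ne (hF : HasCycleFrames f h g k) (hh : IsRegular h) (i j : ℤ) :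
    osc1 h i j ≠ osc2 h i j := by
  intro e
  have hP : finrank K (osc1 h i j) ≤ 3 := (hh.osc1_plane i j).le
  have l1 : join2 (g i j) (g i (j + 1)) ≤ osc1 h i j := by
    have := hF.join_h hh (i - 1) j
    rw [sub_add_cancel] at this
    rw [← this]
    exact le_sup_left
  have l2 : join2 (g (i + 1) j) (g (i + 1) (j + 1)) ≤ osc1 h i j := by
    rw [← hF.join_h hh]
    exact join2_le (le_sup_right.trans le_sup_left) le_sup_right
  have l3 : join2 (f i j) (f (i + 1) j) ≤ osc1 h i j := by
    have hl := hF.isLaplace1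
    have h1 := (hl i (j - 1)).le.trans inf_le_right
    have h2 := hh.ne₂ i (j - 1)
    rw [sub_add_cancel] at h1 h2
    rw [← eq_join2 (finrank_join2_le _ _) h2 h1 ((hl i j).le.trans inf_le_left), e]
    exact le_sup_left
  obtain ⟨F, G, H, N, l, m, hF⟩ := hF i j
  have m1 := (left_le_join2 _ _).trans l1
  have m2 := (left_le_join2 _ _).trans l2
  have m3 := (left_le_join2 _ _).trans l3
  have m4 : (h i j).submodule ≤ osc1 h i j := le_sup_right.trans le_sup_left
  have hfF : (f i j).submodule = span K {F} := hF.frame.a_pt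
  rw [hF.g_a, span_singleton_le] at m1
  rw [hF.g_b, span_singleton_le] at m2
  rw [hfF, span_singleton_le] at m3
  rw [hF.h_eq, span_singleton_le] at m4
  refine hF.frame.indep.notMem_plane hP m3 m1 m4
    ((Submodule.smul_mem_iff _ hF.frame.m_ne).1 ?_)
  have := Submodule.sub_mem _ m1 m2
  rwa [sub_sub_cancel] at this

theorem finrank_face_g (hF : HasCycleFrames f h g k) (i j : ℤ) :
    2 < finrank K (face g i j) ∧ finrank K (face g i j) ≤ 3 := by
  obtain ⟨F, G, H, N, l, m, hF⟩ := hF i j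
  have e : face g i j = span K {G} ⊔ span K {G - m • N} ⊔
      (span K {G - l • H} ⊔ span K {G - l • H - m • N}) := by
    rw [face, join2, join2, hF.g_a, hF.g_b, hF.g_c, hF.g_d]
  constructor
  · by_contra! h2
    have hG : G ∈ face g i j := by
      rw [e]; exact mem_sup_left (mem_sup_left (mem_span_singleton_self _))
    have hN : N ∈ face g i j := by
      refine (Submodule.smul_mem_iff _ hF.frame.m_ne).1 ?_
      have h1 : G - m • N ∈ face g i j := by
        rw [e]; exact mem_sup_left (mem_sup_right (mem_span_singleton_self _))
      have := Submodule.sub_mem _ hG h1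
      rwa [sub_sub_cancel] at this
    have hH : H ∈ face g i j := by
      refine (Submodule.smul_mem_iff _ hF.frame.l_ne).1 ?_
      have h1 : G - l • H ∈ face g i j := by
        rw [e]; exact mem_sup_right (mem_sup_left (mem_span_singleton_self _))
      have := Submodule.sub_mem _ hG h1
      rwa [sub_sub_cancel] at this
    have h3 := Submodule.finrank_add_le_finrank_add_finrank (span K {F}) (face g i j)
    rw [finrank_span_singleton hF.frame.F_ne] at h3
    exact hF.frame.indep.notMem_plane (P := span K {F} ⊔ face g i j) (by omega)
      (mem_sup_left (mem_span_singleton_self _)) (mem_sup_right hG) (mem_sup_right hH)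
      (mem_sup_right hN)
  · refine (finrank_mono ?_).trans (finrank_span_triple_le (a := G) (b := H) (c := N))
    rw [e]
    simp only [sup_le_iff, span_singleton_le, mem_span_triple]
    exact ⟨⟨⟨1, 0, 0, by module⟩, ⟨1, 0, -m, by module⟩⟩, ⟨1, -l, 0, by module⟩,
      ⟨1, -l, -m, by module⟩⟩

/-- Nets with normal forms on all quadrilaterals form a Laplace cycle in general position. -/
theorem isLaplaceCycle (hF : HasCycleFrames f h g k) (hf : IsRegular f) (hh : IsRegular h)
    (hk : IsRegular k) (ho : ∀ i j, osc1 f i j ≠ osc2 f i j) :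
    IsLaplaceCycle f h g k ∧ InGeneralPosition f h g k := by
  -- Transposition exchanges the roles of `h` and `k`, which yields all second-direction claims.
  have hT := hF.transpose
  have hk' := hk.transpose
  have hf' := hf.transpose
  have hgo : ∀ i j, osc1 g i j = osc2 f i j := fun i j => hT.osc2_g hf' hk' j i
  refine ⟨⟨?_, hF.isConjugate_h hh, fun i j => (hF.finrank_face_g i j).2, ?_, hf, hh, ⟨?_, ?_, ?_⟩,
    hk, hF.isLaplace1, fun i j => hT.isLaplace1 j i, hF.isLaplace1_h hh,
    fun i j => hT.isLaplace1_h hk' j i⟩, ⟨?_, ?_, ho, hF.osc_h_ne hh, ?_, ?_, ?_⟩⟩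
  · intro i j
    obtain ⟨F, G, H, N, l, m, hF⟩ := hF i j
    exact hF.frame.finrank_face_le
  · intro i j
    have := hT.isConjugate_h hk' j i
    rwa [face_transpose] at this
  · exact fun i j => hT.finrank_osc2_g hk' j i
  · exact fun i j => hF.finrank_osc2_g hh i j
  · exact fun i j => (hF.finrank_face_g i j).1
  · intro i j e
    obtain ⟨F, G, H, N, l, m, hF⟩ := hF i j
    have e1 : span K {F} = span K {G} :=
      (hF.frame.a_pt.symm.trans (congrArg Projectivization.submodule e)).trans hF.g_a
    obtain ⟨r, -, hr⟩ := exists_smul_of_span_eq hF.frame.G_ne e1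
    have := (hF.frame.indep 1 (-r) 0 0 (by linear_combination (norm := module) hr)).1
    exact one_ne_zero this
  · intro i j e
    obtain ⟨F, G, H, N, l, m, hF⟩ := hF i j
    have e1 : span K {H} = span K {N} :=
      (hF.h_eq.symm.trans (congrArg Projectivization.submodule e)).trans hF.k_eq
    obtain ⟨r, -, hr⟩ := exists_smul_of_span_eq hF.frame.N_ne e1
    have := (hF.frame.indep 0 0 1 (-r) (by linear_combination (norm := module) hr)).2.2.1
    exact one_ne_zero this
  · intro i j e
    rw [hgo, hF.osc2_g hf hh] at e
    exact ho i j e.symm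
  · exact fun i j => (hT.osc_h_ne hk' j i).symm
  · intro i j
    obtain ⟨F, G, H, N, l, m, hF⟩ := hF i j
    exact ⟨hF.frame.skew_ab, hF.frame.skew_ac⟩

end HasCycleFrames

variable {A : Congruence K}

/-- The point of the opposite net at a vertex does not depend on the quadrilateral. -/
theorem HasFrames.corner_unique (hfr : HasFrames fun i j => ((f i j).submodule, A i j))
    (h1 : ∀ i j, A i j ≤ osc1 f i j) (h2 : ∀ i j, A i j ≤ osc2 f i j) {i j i₁ j₁ i₂ j₂ : ℤ}
    (hi₁ : i₁ = i + 1 ∨ i₁ = i + -1) (hj₁ : j₁ = j + 1 ∨ j₁ = j + -1)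
    (hi₂ : i₂ = i + 1 ∨ i₂ = i + -1) (hj₂ : j₂ = j + 1 ∨ j₂ = j + -1)
    {F G H N F' G' H' N' : Fin 4 → K} {l m l' m' : K}
    (hF : QuadFrame ((f i j).submodule, A i j) ((f i₁ j).submodule, A i₁ j)
      ((f i j₁).submodule, A i j₁) ((f i₁ j₁).submodule, A i₁ j₁) F G H N l m)
    (hF' : QuadFrame ((f i j).submodule, A i j) ((f i₂ j).submodule, A i₂ j)
      ((f i j₂).submodule, A i j₂) ((f i₂ j₂).submodule, A i₂ j₂) F' G' H' N' l' m') :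
    span K {G'} = span K {G} := by
  obtain ⟨s, hs, rfl⟩ : ∃ s, (s = 1 ∨ s = -1) ∧ i₁ = i + s := ⟨i₁ - i, by omega, by omega⟩
  obtain ⟨t, ht, rfl⟩ : ∃ t, (t = 1 ∨ t = -1) ∧ j₁ = j + t := ⟨j₁ - j, by omega, by omega⟩
  obtain ⟨s', hs', rfl⟩ : ∃ s, (s = 1 ∨ s = -1) ∧ i₂ = i + s := ⟨i₂ - i, by omega, by omega⟩
  obtain ⟨t', ht', rfl⟩ : ∃ t, (t = 1 ∨ t = -1) ∧ j₂ = j + t := ⟨j₂ - j, by omega, by omega⟩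
  -- An intermediate quadrilateral shares an edge with each of the two given ones.
  obtain ⟨F₁, G₁, H₁, N₁, l₁, m₁, hF₁⟩ := hfr.signs i j hs' ht
  have e1 : span K {G₁} = span K {G} := hF.span_G_eq hF₁ (finrank_join3_le _ _ _)
    (finrank_join3_le _ _ _) (h1 i j) (le_osc1 f i j hs) (le_osc1 f i j hs') (h1 i (j + t))
    (le_osc1 f i (j + t) hs) (le_osc1 f i (j + t) hs')
  have e2 : span K {G'} = span K {G₁} := hF₁.swap.span_G_eq hF'.swap (finrank_join3_le _ _ _)
    (finrank_join3_le _ _ _) (h2 i j) (le_osc2 f i j ht) (le_osc2 f i j ht') (h2 (i + s') j)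
    (le_osc2 f (i + s') j ht) (le_osc2 f (i + s') j ht')
  exact e2.trans e1

theorem HasFrames.exists_cycleFrames (hfr : HasFrames fun i j => ((f i j).submodule, A i j))
    (h1 : ∀ i j, A i j ≤ osc1 f i j) (h2 : ∀ i j, A i j ≤ osc2 f i j) :
    ∃ h g k : Net K, diagonal f g = A ∧ HasCycleFrames f h g k := by
  choose F G H N l m hF using hfr
  choose g hg using fun i j => Pt.exists_of_vec (hF i j).G_ne
  choose h hh using fun i j => Pt.exists_of_vec (hF i j).H_ne
  choose k hk using fun i j => Pt.exists_of_vec (hF i j).N_ne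
  have hd : diagonal f g = A := by
    funext i j
    have e1 : (f i j).submodule = span K {F i j} := (hF i j).a_pt
    have e2 : A i j = span K {F i j, G i j} := (hF i j).a_line
    rw [diagonal, join2, e1, hg, e2, span_sup_span]
  have hfr : HasFrames fun i j => ((f i j).submodule, A i j) :=
    fun i j => ⟨_, _, _, _, _, _, hF i j⟩
  refine ⟨h, g, k, hd, fun i j => ⟨F i j, G i j, H i j, N i j, l i j, m i j, ?_, hg i j, ?_, ?_, ?_,
    hh i j, hk i j⟩⟩
  · simp only [cycleFlag, hd]
    exact hF i j
  · rw [hg]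
    exact hfr.corner_unique h1 h2 (by omega) (by omega) (by omega) (by omega) (hF i j).flip
      (hF (i + 1) j)
  · rw [hg]
    exact hfr.corner_unique h1 h2 (by omega) (by omega) (by omega) (by omega) (hF i j).flip'
      (hF i (j + 1))
  · rw [hg]
    have e : G i j - l i j • H i j - m i j • N i j =
        G i j - m i j • N i j - -l i j • -H i j := by module
    rw [e]
    exact hfr.corner_unique h1 h2 (by omega) (by omega) (by omega) (by omega)
      (hF i j).flip.flip' (hF (i + 1) (j + 1))

/-- If the osculating planes of the first family contain the lines, and those of the second
family do so in two columns, then they do so everywhere. -/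
theorem HasFrames.le_osc2 (hfr : HasFrames fun i j => ((f i j).submodule, A i j))
    (h1 : ∀ i j, A i j ≤ osc1 f i j) (c0 : ∀ j, A 0 j ≤ osc2 f 0 j)
    (c1 : ∀ j, A 1 j ≤ osc2 f 1 j) (i j : ℤ) : A i j ≤ osc2 f i j := by
  refine int_induction_two (Q := fun i => ∀ j, A i j ≤ osc2 f i j) c0 c1 ?_ i j
  intro i s hs hi hi' j
  rw [sub_eq_add_neg] at hi'
  have hs : s = 1 ∨ s = -1 := by omega
  have p1 : (1 : ℤ) = 1 ∨ (1 : ℤ) = -1 := by simp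
  have n1 : (-1 : ℤ) = 1 ∨ (-1 : ℤ) = -1 := by simp
  obtain ⟨_, G₁, _, _, _, _, f₁⟩ := hfr.signs i j hs p1
  obtain ⟨_, G₂, _, _, _, _, f₂⟩ := hfr.signs i j hs n1
  obtain ⟨_, G₃, _, _, _, _, f₃⟩ := hfr.signs i j (neg_sign hs) p1
  obtain ⟨_, G₄, _, _, _, _, f₄⟩ := hfr.signs i j (neg_sign hs) n1
  -- Around (i, j), the first osculating planes compare G across the two vertical edges, and the
  -- second ones in the known columns i and i - s compare it across the horizontal edge towards i -
  -- s. Going around, the two frames on the side of i + s agree, which is what `line_b_le` needs to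
  -- reach column i + s.
  have e1 : span K {G₃} = span K {G₁} := f₁.span_G_eq f₃ (finrank_join3_le _ _ _)
    (finrank_join3_le _ _ _) (h1 i j) (le_osc1 f i j hs) (le_osc1 f i j (neg_sign hs))
    (h1 i (j + 1)) (le_osc1 f i (j + 1) hs) (le_osc1 f i (j + 1) (neg_sign hs))
  have e2 : span K {G₄} = span K {G₂} := f₂.span_G_eq f₄ (finrank_join3_le _ _ _)
    (finrank_join3_le _ _ _) (h1 i j) (le_osc1 f i j hs) (le_osc1 f i j (neg_sign hs))
    (h1 i (j + -1)) (le_osc1 f i (j + -1) hs) (le_osc1 f i (j + -1) (neg_sign hs))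
  have e3 : span K {G₄} = span K {G₃} := f₃.swap.span_G_eq f₄.swap (finrank_join3_le _ _ _)
    (finrank_join3_le _ _ _) (hi j) (LaplaceCycles.le_osc2 f i j p1)
    (LaplaceCycles.le_osc2 f i j n1) (hi' j) (LaplaceCycles.le_osc2 f (i + -s) j p1)
    (LaplaceCycles.le_osc2 f (i + -s) j n1)
  have hosc : ∀ i, osc2 f i j =
      (f i (j + -1)).submodule ⊔ (f i j).submodule ⊔ (f i (j + 1)).submodule := fun i => rfl
  have hij := hi j
  rw [hosc] at hij ⊢
  have key := f₁.line_b_le f₂ (e2.symm.trans (e3.trans e1))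
  exact key hij

end Existence

/-! ### A construction without singularities yields a cycle. -/

section Construction

variable {K : Type*} [Field K] {f : Net K} {A : Congruence K}

theorem IsRegular.not_collinear_signs (hf : IsRegular f) (i j : ℤ) {s t : ℤ}
    (hs : s = 1 ∨ s = -1) (ht : t = 1 ∨ t = -1) {L : Sub K} (hL : finrank K L ≤ 2)
    (h₁ : (f i j).submodule ≤ L) (h₂ : (f (i + s) j).submodule ≤ L)
    (h₃ : (f i (j + t)).submodule ≤ L) (h₄ : (f (i + s) (j + t)).submodule ≤ L) : False := by
  have key : ∀ i j, (f i j).submodule ≤ L → (f (i + 1) j).submodule ≤ L →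
      (f i (j + 1)).submodule ≤ L → (f (i + 1) (j + 1)).submodule ≤ L → False := by
    intro i j h₁ h₂ h₃ h₄
    have h5 := hf.not_collinear i j
    have h6 := finrank_mono (R := K) (show face f i j ≤ L from
      sup_le (join2_le h₁ h₂) (join2_le h₃ h₄))
    omega
  rcases hs with rfl | rfl <;> rcases ht with rfl | rfl
  · exact key i j h₁ h₂ h₃ h₄
  · exact key i (j + -1) h₃ h₄ (by rwa [neg_add_cancel_right]) (by rwa [neg_add_cancel_right])
  · exact key (i + -1) j h₂ (by rwa [neg_add_cancel_right]) h₄ (by rwa [neg_add_cancel_right])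
  · refine key (i + -1) (j + -1) h₄ ?_ ?_ ?_ <;> simpa only [neg_add_cancel_right]

theorem line_le_osc1 (hf : IsRegular f) (hA : ∀ i j, IsLine (A i j))
    (hm : ∀ i j, (f i j).submodule ≤ A i j) {i j s : ℤ} (hs : s = 1 ∨ s = -1)
    (h : (f (i + s) j).submodule ≤ (f (i - s) j).submodule ⊔ A i j) : A i j ≤ osc1 f i j := by
  have h3 := finrank_point_sup_line (Pt.finrank (f (i - s) j)).le (hA i j)
  have h1 : osc1 f i j ≤ (f (i - s) j).submodule ⊔ A i j := by
    rcases hs with rfl | rfl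
    · exact sup_le (sup_le le_sup_left ((hm i j).trans le_sup_right)) h
    · rw [sub_neg_eq_add] at h ⊢
      exact sup_le (sup_le h ((hm i j).trans le_sup_right)) le_sup_left
  -- The plane of the projection step contains three consecutive points of the net, so by regularity
  -- it is their osculating plane.
  rw [eq_of_le_of_finrank_le h1 (by rw [hf.osc1_plane]; exact h3)]
  exact le_sup_right

theorem line_le_osc2 (hf : IsRegular f) (hA : ∀ i j, IsLine (A i j))
    (hm : ∀ i j, (f i j).submodule ≤ A i j) {i j t : ℤ} (ht : t = 1 ∨ t = -1)
    (h : (f i (j + t)).submodule ≤ (f i (j - t)).submodule ⊔ A i j) : A i j ≤ osc2 f i j :=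
  line_le_osc1 (f := transpose f) (A := fun i j => A j i) (i := j) (j := i) hf.transpose
    (fun i j => hA j i) (fun i j => hm j i) ht h

/-- A quadrilateral with lines in a regulus and osculating planes through these lines has
a normal form. -/
theorem exists_quadFrame_of_osc (hf : IsRegular f) (ho : ∀ i j, osc1 f i j ≠ osc2 f i j)
    (hA : ∀ i j, IsLine (A i j)) (hadj : AdjacentSkew A) (hopp : OppositeSkew A)
    (hm : ∀ i j, (f i j).submodule ≤ A i j) (h1 : ∀ i j, A i j ≤ osc1 f i j) (i j : ℤ)
    (h2 : ∀ j, A i j ≤ osc2 f i j) (h2' : ∀ j, A (i + 1) j ≤ osc2 f (i + 1) j)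
    (hreg : A (i + 1) (j + 1) ∈ regulus (A i j) (A (i + 1) j) (A i (j + 1)))
    (hπ : (f (i + 1) (j + 1)).submodule ≤
      (f i j).submodule ⊔ (f (i + 1) j).submodule ⊔ (f i (j + 1)).submodule) :
    ∃ F G H N l m, QuadFrame ((f i j).submodule, A i j) ((f (i + 1) j).submodule, A (i + 1) j)
      ((f i (j + 1)).submodule, A i (j + 1))
      ((f (i + 1) (j + 1)).submodule, A (i + 1) (j + 1)) F G H N l m := by
  have p1 : (1 : ℤ) = 1 ∨ (1 : ℤ) = -1 := by simp
  have n1 : (-1 : ℤ) = 1 ∨ (-1 : ℤ) = -1 := by simp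
  -- Both osculating planes at a vertex contain its line, so a further common point off that line
  -- would make them equal. Each collinearity excluded below produces such a point at some corner.
  have corner : ∀ i j, A i j ≤ osc2 f i j → ∀ p : Pt K, ¬ p.submodule ≤ A i j →
      p.submodule ≤ osc1 f i j → p.submodule ≤ osc2 f i j → False :=
    fun i j h p hp q1 q2 => ho i j (plane_eq (hA i j) hp (finrank_join3_le _ _ _)
      (finrank_join3_le _ _ _) (h1 i j) h q1 q2)
  have o1 : ∀ i j, (f i j).submodule ≤ osc1 f i j := fun i j => (hm i j).trans (h1 i j)
  have o2 : ∀ i j, (f i j).submodule ≤ osc2 f i j := fun i j => le_sup_right.trans le_sup_left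
  have b1 : ∀ i j, (f i j).submodule ≤ osc1 f (i + 1) j := fun i j => by
    simpa only [add_neg_cancel_right] using le_osc1 f (i + 1) j n1
  have b2 : ∀ i j, (f i j).submodule ≤ osc2 f i (j + 1) := fun i j => by
    simpa only [add_neg_cancel_right] using le_osc2 f i (j + 1) n1
  refine RegulusQuad.exists_quadFrame ⟨hA _ _, hA _ _, hA _ _, (hadj i j).1, (hadj i j).2,
    (hopp i j).2, (hopp i j).1, (hadj (i + 1) j).2, (hadj i (j + 1)).1, hm _ _, hm _ _, hm _ _,
    hm _ _, hreg⟩ hπ ?_ ?_ ?_ (fun L hL => hf.not_collinear_signs i j p1 p1 hL)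
  · intro h
    have hne : f (i + 1) (j + 1) ≠ f (i + 1) j := (hf.ne₂ (i + 1) j).symm
    refine corner (i + 1) (j + 1) (h2' _) (f i (j + 1))
      (Pt.not_le_of_skew (hadj i (j + 1)).1 (hm _ _)) (b1 _ _) ?_
    exact (Pt.exchange h hne).trans (sup_le (b2 _ _) (o2 _ _))
  · intro h
    exact corner i (j + 1) (h2 _) (f (i + 1) (j + 1))
      (Pt.not_le_of_skew (hadj i (j + 1)).1.symm (hm _ _)) (le_osc1 f i (j + 1) p1)
      (h.trans (sup_le (b2 _ _) (o2 _ _)))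
  · intro h
    exact corner (i + 1) j (h2' _) (f (i + 1) (j + 1))
      (Pt.not_le_of_skew (hadj (i + 1) j).2.symm (hm _ _))
      (h.trans (sup_le (b1 _ _) (o1 _ _))) (le_osc2 f (i + 1) j p1)

theorem HasFrames.of_signs {a : ℤ → ℤ → Flag K} {i j i' j' s t : ℤ}
    (hs : i' = i ∧ s = 1 ∨ i' = i + 1 ∧ s = -1) (ht : j' = j ∧ t = 1 ∨ j' = j + 1 ∧ t = -1)
    (h : ∃ F G H N l m, QuadFrame (a i' j') (a (i' + s) j') (a i' (j' + t)) (a (i' + s) (j' + t))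
      F G H N l m) :
    ∃ F G H N l m, QuadFrame (a i j) (a (i + 1) j) (a i (j + 1)) (a (i + 1) (j + 1))
      F G H N l m := by
  obtain ⟨F, G, H, N, l, m, hF⟩ := h
  rcases hs with ⟨rfl, rfl⟩ | ⟨rfl, rfl⟩ <;> rcases ht with ⟨rfl, rfl⟩ | ⟨rfl, rfl⟩
  · exact ⟨_, _, _, _, _, _, hF⟩
  · simp only [add_neg_cancel_right] at hF
    exact ⟨_, _, _, _, _, _, hF.flip'⟩
  · simp only [add_neg_cancel_right] at hF
    exact ⟨_, _, _, _, _, _, hF.flip⟩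
  · simp only [add_neg_cancel_right] at hF
    exact ⟨_, _, _, _, _, _, hF.flip.flip'⟩

/-- A construction without singularities yields a cycle. -/
theorem AxisData.ConstructionRegular.exists_cycle {d : AxisData K} {x : Pt K}
    (hd : d.IsSuitable) (hx : x ∈ d.conic) (hc : d.ConstructionRegular x) :
    ∃ f h g k : Net K, IsLaplaceCycle f h g k ∧ InGeneralPosition f h g k ∧
      OppositeSkew (diagonal f g) ∧ axisData f g = d ∧ f 1 1 = x := by
  obtain ⟨f, A, hfA, hA, hadj, hopp, hf, ho, hl1, hl2⟩ := hc
  have p1 : (1 : ℤ) = 1 ∨ (1 : ℤ) = -1 := by simp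
  have h0 : d.row0 0 = d.col0 0 :=
    Prod.ext (congrArg Projectivization.submodule hd.f_origin) hd.A_origin
  have hrow : ∀ i, d.row0 i = ((f i 0).submodule, A i 0) := fun i =>
    (construct_row_zero d x i).symm.trans (hfA i 0)
  have hcol : ∀ j, d.col0 j = ((f 0 j).submodule, A 0 j) := fun j =>
    (construct_col_zero d x h0 j).symm.trans (hfA 0 j)
  have hfx : ∀ i, d.fx i = f i 0 := fun i =>
    Projectivization.submodule_injective (congrArg Prod.fst (hrow i))
  have hfy : ∀ j, d.fy j = f 0 j := fun j =>
    Projectivization.submodule_injective (congrArg Prod.fst (hcol j))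
  have hAx : ∀ i, d.Ax i = A i 0 := fun i => congrArg Prod.snd (hrow i)
  have hAy : ∀ j, d.Ay j = A 0 j := fun j => congrArg Prod.snd (hcol j)
  have hone := (construct_one_one d x).symm.trans (hfA 1 1)
  have hx11 : x = f 1 1 := Projectivization.submodule_injective (congrArg Prod.fst hone)
  have hreg := regulusLine_spec (hA 1 1) (congrArg Prod.snd hone)
  subst hx11
  obtain ⟨-, hπ⟩ := hx
  rw [join3, hfx, hfx, hfy] at hπ
  rw [hAx, hAx, hAy] at hreg
  have stepH : ∀ i j s t : ℤ, 1 ≤ i ∧ s = 1 ∨ i ≤ 0 ∧ s = -1 → 0 ≤ j ∧ t = 1 ∨ j ≤ 0 ∧ t = -1 →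
      (f i j).submodule ≤ A i j → (f (i + s) j).submodule ≤ A (i + s) j →
      (f i (j + t)).submodule ≤ A i (j + t) →
      (f (i + s) (j + t)).submodule ≤ A (i + s) (j + t) ∧
      (f (i + s) (j + t)).submodule ≤ (f (i - s) (j + t)).submodule ⊔ A i (j + t) ∧
      ∃ F G H N l m, QuadFrame ((f i j).submodule, A i j)
        ((f (i + s) j).submodule, A (i + s) j) ((f i (j + t)).submodule, A i (j + t))
        ((f (i + s) (j + t)).submodule, A (i + s) (j + t)) F G H N l m := by
    intro i j s t hs ht ma mb mc
    have hs' : s = 1 ∨ s = -1 := by omega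
    have ht' : t = 1 ∨ t = -1 := by omega
    have e := construct_horizontal d (f 1 1) hs ht
    simp only [hfA] at e
    exact exists_quadFrame_of_nextFlag (hA _ _) (hA _ _) (hA _ _) (hA _ _)
      (hadj.horizontal i j hs') (hadj.vertical i j ht') (hopp.signs i j hs' ht').2
      (hopp.signs i j hs' ht').1 (hadj.vertical (i + s) j ht') (hadj.horizontal i (j + t) hs')
      ma mb mc e (fun L hL => hf.not_collinear_signs i j hs' ht' hL)
  have stepV : ∀ j t : ℤ, 1 ≤ j ∧ t = 1 ∨ j ≤ 0 ∧ t = -1 →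
      (f 0 j).submodule ≤ A 0 j → (f 0 (j + t)).submodule ≤ A 0 (j + t) →
      (f 1 j).submodule ≤ A 1 j →
      (f 1 (j + t)).submodule ≤ A 1 (j + t) ∧
      (f 1 (j + t)).submodule ≤ (f 1 (j - t)).submodule ⊔ A 1 j ∧
      ∃ F G H N l m, QuadFrame ((f 0 j).submodule, A 0 j)
        ((f 0 (j + t)).submodule, A 0 (j + t)) ((f 1 j).submodule, A 1 j)
        ((f 1 (j + t)).submodule, A 1 (j + t)) F G H N l m := by
    intro j t ht ma mb mc
    have ht' : t = 1 ∨ t = -1 := by omega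
    have e := construct_vertical d (f 1 1) h0 ht
    simp only [hfA] at e
    have o := hopp.signs 0 j p1 ht'
    have a1 := hadj.horizontal 0 j p1
    have a2 := hadj.horizontal 0 (j + t) p1
    have c := fun (L : Sub K) (hL : finrank K L ≤ 2) => hf.not_collinear_signs 0 j p1 ht' hL
    simp only [zero_add] at o a1 a2 c
    exact exists_quadFrame_of_nextFlag (hA _ _) (hA _ _) (hA _ _) (hA _ _)
      (hadj.vertical 0 j ht') a1 o.2.symm o.1 a2 (hadj.vertical 1 j ht')
      ma mb mc e (fun L hL h₁ h₂ h₃ h₄ => c L hL h₁ h₃ h₂ h₄)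
  -- A step needs incidence at its three known corners and returns it at the fourth, so incidence
  -- spreads in the order of the construction.
  have hm : ∀ i j, (f i j).submodule ≤ A i j := by
    refine grid_induction (fun i => ?_) (fun j => ?_) hreg.2 ?_ ?_
    · rw [← hfx, ← hAx]; exact hd.mem_x i
    · rw [← hfy, ← hAy]; exact hd.mem_y j
    · exact fun j t ht m1 m2 m3 _ => (stepV j t ht m1 m2 m3).1
    · exact fun i j s t hs ht m1 m2 m3 _ => (stepH i j s t hs ht m1 m2 m3).1
  -- Every vertex off the first axis is the pivot of a horizontal step pointing outwards; on the
  -- axis the claim is part of suitability.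
  have h1 : ∀ i j, A i j ≤ osc1 f i j := by
    intro i j
    obtain ⟨s, hs⟩ : ∃ s : ℤ, 1 ≤ i ∧ s = 1 ∨ i ≤ 0 ∧ s = -1 := by
      rcases le_or_gt 1 i with hi | hi
      · exact ⟨1, Or.inl ⟨hi, rfl⟩⟩
      · exact ⟨-1, Or.inr ⟨by omega, rfl⟩⟩
    rcases eq_or_ne j 0 with rfl | hj
    · have := hd.osc_x i
      rwa [hAx, hfx, hfx, hfx] at this
    · obtain ⟨j', t, ht, rfl⟩ : ∃ j' t : ℤ, (0 ≤ j' ∧ t = 1 ∨ j' ≤ 0 ∧ t = -1) ∧ j = j' + t := by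
        rcases lt_or_gt_of_ne hj with hj | hj
        · exact ⟨j + 1, -1, Or.inr ⟨by omega, rfl⟩, by omega⟩
        · exact ⟨j - 1, 1, Or.inl ⟨by omega, rfl⟩, by omega⟩
      exact line_le_osc1 hf hA hm (by omega)
        (stepH i j' s t hs ht (hm _ _) (hm _ _) (hm _ _)).2.1
  have c0 : ∀ j, A 0 j ≤ osc2 f 0 j := by
    intro j
    have := hd.osc_y j
    rwa [hAy, hfy, hfy, hfy] at this
  have c1 : ∀ j, A 1 j ≤ osc2 f 1 j := by
    intro j
    obtain ⟨t, ht⟩ : ∃ t : ℤ, 1 ≤ j ∧ t = 1 ∨ j ≤ 0 ∧ t = -1 := by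
      rcases le_or_gt 1 j with hj | hj
      · exact ⟨1, Or.inl ⟨hj, rfl⟩⟩
      · exact ⟨-1, Or.inr ⟨by omega, rfl⟩⟩
    exact line_le_osc2 hf hA hm (by omega) (stepV j t ht (hm _ _) (hm _ _) (hm _ _)).2.1
  have hfr : HasFrames fun i j => ((f i j).submodule, A i j) := by
    intro i j
    obtain ⟨j', t, ht, htj⟩ : ∃ j' t : ℤ, (0 ≤ j' ∧ t = 1 ∨ j' ≤ 0 ∧ t = -1) ∧
        (j' = j ∧ t = 1 ∨ j' = j + 1 ∧ t = -1) := by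
      rcases le_or_gt 0 j with hj | hj
      · exact ⟨j, 1, Or.inl ⟨hj, rfl⟩, Or.inl ⟨rfl, rfl⟩⟩
      · exact ⟨j + 1, -1, Or.inr ⟨by omega, rfl⟩, Or.inr ⟨rfl, rfl⟩⟩
    rcases eq_or_ne i 0 with rfl | hi
    · rcases eq_or_ne j 0 with rfl | hj
      -- The quadrilateral at the origin arises from the chosen x, not from a projection, so its
      -- nondegeneracy is drawn from the distinct osculating planes. The rest of this strip comes
      -- from vertical steps and all other strips from horizontal ones.
      · exact exists_quadFrame_of_osc hf ho hA hadj hopp hm h1 0 0 c0 c1 hreg.1 hπ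
      · refine HasFrames.of_signs (a := fun i j => ((f i j).submodule, A i j)) (i' := 0) (s := 1)
          (Or.inl ⟨rfl, rfl⟩) htj ?_
        obtain ⟨-, -, F, G, H, N, l, m, hF⟩ :=
          stepV j' t (by omega) (hm _ _) (hm _ _) (hm _ _)
        exact ⟨_, _, _, _, _, _, hF.swap⟩
    · obtain ⟨i', s, hs, hsi⟩ : ∃ i' s : ℤ, (1 ≤ i' ∧ s = 1 ∨ i' ≤ 0 ∧ s = -1) ∧
          (i' = i ∧ s = 1 ∨ i' = i + 1 ∧ s = -1) := by
        rcases lt_or_gt_of_ne hi with hi | hi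
        · exact ⟨i + 1, -1, Or.inr ⟨by omega, rfl⟩, Or.inr ⟨rfl, rfl⟩⟩
        · exact ⟨i, 1, Or.inl ⟨by omega, rfl⟩, Or.inl ⟨rfl, rfl⟩⟩
      exact HasFrames.of_signs (a := fun i j => ((f i j).submodule, A i j)) hsi htj
        (stepH i' j' s t hs ht (hm _ _) (hm _ _) (hm _ _)).2.2
  obtain ⟨h, g, k, hdiag, hcf⟩ := hfr.exists_cycleFrames h1 (hfr.le_osc2 h1 c0 c1)
  have hcyc := hcf.isLaplaceCycle hf (hl1 h hcf.isLaplace1)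
    (hl2 k fun i j => hcf.transpose.isLaplace1 j i) ho
  refine ⟨f, h, g, k, hcyc.1, hcyc.2, hdiag ▸ hopp, ?_, rfl⟩
  unfold axisData
  rw [hdiag]
  ext1
  · exact funext fun i => (hfx i).symm
  · exact funext fun j => (hfy j).symm
  · exact funext fun i => (hAx i).symm
  · exact funext fun j => (hAy j).symm

end Construction
end LaplaceCycles

open LaplaceCycles in
theorem theorem22 {K : Type*} [Field K] (hK : ringChar K ≠ 2) :
    -- the values of a cycle on the axes are in suitable position, and `f 1 1` is on the conic
    (∀ f h g k : Net K, IsLaplaceCycle f h g k → InGeneralPosition f h g k →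
      (axisData f g).IsSuitable ∧
      (Skew (diagonal f g 1 0) (diagonal f g 0 1) → f 1 1 ∈ (axisData f g).conic)) ∧
    -- uniqueness
    (∀ f h g k f' h' g' k' : Net K,
      IsLaplaceCycle f h g k → InGeneralPosition f h g k →
      IsLaplaceCycle f' h' g' k' → InGeneralPosition f' h' g' k' →
      axisData f g = axisData f' g' → f 1 1 = f' 1 1 →
      f = f' ∧ h = h' ∧ g = g' ∧ k = k') ∧
    -- existence, whenever the construction meets no singularity, and only then
    (∀ d : AxisData K, d.IsSuitable → Skew (d.Ax 1) (d.Ay 1) → ∀ x ∈ d.conic,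
      ((∃ f h g k : Net K, IsLaplaceCycle f h g k ∧ InGeneralPosition f h g k ∧
          OppositeSkew (diagonal f g) ∧ axisData f g = d ∧ f 1 1 = x) ↔
        d.ConstructionRegular x)) ∧
    -- the projections agree on all routes through the net
    (∀ f h g k : Net K, IsLaplaceCycle f h g k → InGeneralPosition f h g k →
      OppositeSkew (diagonal f g) →
      ∀ i j s t : ℤ, (s = 1 ∨ s = -1) → (t = 1 ∨ t = -1) →
        nextFlag (cycleFlag f g i j) (cycleFlag f g (i + s) j) (cycleFlag f g i (j + t))
            (cycleFlag f g (i - s) (j + t)).1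
          = cycleFlag f g (i + s) (j + t) ∧
        nextFlag (cycleFlag f g i j) (cycleFlag f g i (j + t)) (cycleFlag f g (i + s) j)
            (cycleFlag f g (i + s) (j - t)).1
          = cycleFlag f g (i + s) (j + t)) := by
  refine ⟨fun f h g k hc hp => ⟨hc.isSuitable hp, hc.mem_conic hp⟩,
    fun f h g k f' h' g' k' hc hp hc' hp' hd h11 => hc.unique hp hc' hp' hd h11,
    fun d hd _ x hx => ⟨?_, fun hr => hr.exists_cycle hd hx⟩,
    fun f h g k hc hp ho i j s t hs ht => hc.nextFlag_eq hp ho i j hs ht⟩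
  rintro ⟨f, h, g, k, hc, hp, ho, rfl, rfl⟩
  exact hc.constructionRegular hp ho
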